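/- For a finite simple graph $G$ with vertex set $V(G)$ and a set $S\subseteq V(G)$ with $|S|\ge 2$, let $\lambda(S)$ be the maximum number of pairwise edge-disjoint trees in $G$ each of which contains all vertices of $S$, and let $\lambda_k(G)=\min\{\lambda(S): S\subseteq V(G),\ |S|=k\}$ (so $\lambda_k(G)=0$ if $G$ is disconnected). Write $\overline G$ for the complement of $G$. For integers $n,m,k$ put $$L(n,m)=\begin{cases}\max\{1,\lfloor\frac12(n-2-m)\rfloor\} & \text{if } \lfloor\frac n3\rfloor+1\le m\le\binom n2,\\ \min\{n-2m-1,\lfloor\frac n2-\frac{2m}{n-1}\rfloor\} & \text{if } 0\le m\le\lfloor\frac n3\rfloor,\end{cases}$$ $$M(n,m)=\begin{cases} n-\lceil\frac k2\rceil & \text{if } m\ge n-1,\text{ or } k \text{ is even and } m=0,\text{ or } k\text{ is odd and }0\le m\le\frac{k-1}2,\\ n-\lceil\frac k2\rceil-1 & \text{if } k\text{ is even and }1\le m<n-1,\text{ or } k\text{ is odd and }\frac{k+1}2\le m<n-1,\end{cases}$$ $$N(n,m)=\begin{cases}0 & \text{if } 0\le m\le n-2,\\ (\frac{2m}n-1)(n-2-\frac{2m}n)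 & \text{if } m\ge n-1\text{ and } n\mid 2m,\\ \lfloor\frac{2m}n\rfloor(n-2-\lfloor\frac{2m}n\rfloor) & \text{otherwise.}\end{cases}$$ Let $n\ge 6$ and $3\le k\le n$. Then for every graph $G$ with $n$ vertices and $m$ edges: (1) $L(n,m)\le\lambda_k(G)+\lambda_k(\overline G)\le M(n,m)$; (2) $0\le\lambda_k(G)\cdot\lambda_k(\overline G)$, and $\lambda_k(G)\cdot\lambda_k(\overline G)\le N(n,m)$ if $m<\binom n2$ (that is, if $G$ is not complete). Moreover, the bounds are sharp, in each case of the definitions of $L$, $M$, $N$, in the following sense. - $L$: equality holds for some $m$ with $\lfloor\frac n3\rfloor+1\le m\le\binom n2$ and some graph with $n$ vertices and $m$ edges; if $k=n$, equality holds for some $m\le\lfloor\frac n3\rfloor$ and some such graph. - $M$: equality holds for some $m\ge n-1$ and some such graph; for $m=0$ if $k$ is even, and for every $m$ with $0\le m\le\frac{k-1}2$ if $k$ is odd, and some such graph; and for some $m<n-1$ with $m\ge1$ if $k$ is even, $m\ge\frac{k+1}2$ if $k$ is odd, and some such graph. - Lower bound $0$ in (2): equality holds for every $m\le\binom n2$ and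 some such graph. - $N$: equality holds for every $m\le n-2$ and some such graph; if $k=3$ and $n\ge9$, for $m=n$ (where $n\mid 2m$) and some such graph; and for some $m$ with $n-1\le m<\binom n2$ and $n\nmid 2m$ and some such graph. In this last case equality with a positive value occurs at order $4$: $N(4,3)>0$ and some graph with $4$ vertices and $3$ edges has $\lambda_3(G)\cdot\lambda_3(\overline G)=N(4,3)$. -/

import Mathlib

/-- A subgraph `T` of `G` is an `S`-Steiner tree if it is a tree and contains all vertices of `S`. -/
def IsSteinerTree {V : Type*} (G : SimpleGraph V) (S : Finset V) (T : G.Subgraph) : Prop :=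
  T.coe.IsTree ∧ (S : Set V) ⊆ T.verts

/-- `G` contains `l` pairwise edge-disjoint `S`-Steiner trees. -/
def HasSteinerPacking {V : Type*} (G : SimpleGraph V) (S : Finset V) (l : ℕ) : Prop :=
  ∃ T : Fin l → G.Subgraph, (∀ i, IsSteinerTree G S (T i)) ∧
    ∀ i j, i ≠ j → Disjoint (T i).edgeSet (T j).edgeSet

/-- The generalized local edge-connectivity `λ(S)`: the maximum number of pairwise edge-disjoint
`S`-Steiner trees. For a finite graph and `2 ≤ |S|` the set below is bounded (every such tree has
an edge) and contains `0`, so that the supremum is a maximum. -/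
noncomputable def localEdgeConn {V : Type*} (G : SimpleGraph V) (S : Finset V) : ℕ :=
  sSup {l : ℕ | HasSteinerPacking G S l}

/-- The generalized `k`-edge-connectivity `λ_k(G)`: the minimum of `λ(S)` over all `k`-element sets
`S` of vertices. For `2 ≤ k ≤ |V|` and disconnected `G` the value is `0`
(`genEdgeConn_of_not_connected`). -/
noncomputable def genEdgeConn {V : Type*} (G : SimpleGraph V) (k : ℕ) : ℕ :=
  sInf {l : ℕ | ∃ S : Finset V, S.card = k ∧ l = localEdgeConn G S}

theorem genEdgeConn_of_not_connected {V : Type*} [Fintype V] (G : SimpleGraph V) (k : ℕ)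
    (hk : 2 ≤ k) (hkV : k ≤ Fintype.card V) (hG : ¬ G.Connected) : genEdgeConn G k = 0 := by
  classical
  have hne : Nonempty V := Fintype.card_pos_iff.mp (by omega)
  have h : ∃ u v : V, ¬ G.Reachable u v := by
    by_contra hc
    push Not at hc
    exact hG ⟨hc⟩
  obtain ⟨u, v, huv⟩ := h
  have hc : ({u, v} : Finset V).card ≤ k := Finset.card_le_two.trans hk
  obtain ⟨S, hS, hSk⟩ := Finset.exists_superset_card_eq hc hkV
  apply Nat.sInf_eq_zero.mpr
  refine Or.inl ⟨S, hSk, ?_⟩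
  symm
  have hz : {l : ℕ | HasSteinerPacking G S l} ⊆ {0} := by
    rintro l ⟨T, hT, -⟩
    by_contra hl
    have hl' : 0 < l := Nat.pos_of_ne_zero hl
    obtain ⟨ht, hs⟩ := hT ⟨0, hl'⟩
    have hu : u ∈ (T ⟨0, hl'⟩).verts := hs (by exact_mod_cast hS (by simp))
    have hv : v ∈ (T ⟨0, hl'⟩).verts := hs (by exact_mod_cast hS (by simp))
    have hr := ht.1.preconnected ⟨u, hu⟩ ⟨v, hv⟩
    exact huv (hr.map (T ⟨0, hl'⟩).hom)
  have h2 := csSup_le_csSup' (s := {l : ℕ | HasSteinerPacking G S l}) (t := {0})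
    (bddAbove_singleton) hz
  simpa [localEdgeConn] using h2

/-- The lower bound `L(n,m)` for the sum. -/
def boundL (n m : ℕ) : ℤ :=
  if m ≤ n / 3 then
    min ((n : ℤ) - 2 * m - 1) ⌊(n : ℚ) / 2 - 2 * (m : ℚ) / ((n : ℚ) - 1)⌋
  else
    max 1 ⌊((n : ℚ) - 2 - m) / 2⌋

/-- The case distinction for the upper bound `M(n,m)`: `m ≥ n - 1`, or `k` even and `m = 0`, or
`k` odd and `m ≤ (k - 1) / 2`. -/
def FirstCaseM (k n m : ℕ) : Prop :=
  n - 1 ≤ m ∨ (Even k ∧ m = 0) ∨ (Odd k ∧ m ≤ (k - 1) / 2)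

open Classical in
/-- The upper bound `M(n,m)` for the sum (it depends on `k` as well). -/
noncomputable def boundM (k n m : ℕ) : ℤ :=
  if FirstCaseM k n m then (n : ℤ) - ⌈(k : ℚ) / 2⌉ else (n : ℤ) - ⌈(k : ℚ) / 2⌉ - 1

/-- The upper bound `N(n,m)` for the product. In the second case the quotient is exact. -/
def boundN (n m : ℕ) : ℤ :=
  if m + 2 ≤ n then 0
  else if n ∣ 2 * m then
    (((2 * m / n : ℕ) : ℤ) - 1) * ((n : ℤ) - 2 - ((2 * m / n : ℕ) : ℤ))
  else
    ⌊2 * (m : ℚ) / n⌋ * ((n : ℤ) - 2 - ⌊2 * (m : ℚ) / n⌋)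

/-- `λ_k(G) + λ_k(Gᶜ)`, as an integer. -/
noncomputable def connSum {V : Type*} (G : SimpleGraph V) (k : ℕ) : ℤ :=
  (genEdgeConn G k : ℤ) + (genEdgeConn Gᶜ k : ℤ)

/-- `λ_k(G) · λ_k(Gᶜ)`, as an integer. -/
noncomputable def connProd {V : Type*} (G : SimpleGraph V) (k : ℕ) : ℤ :=
  (genEdgeConn G k : ℤ) * (genEdgeConn Gᶜ k : ℤ)

/-! Trees are replaced by arbitrary edge-disjoint subgraphs that link $S$: each of these contains a
Steiner tree, so the maximum is unchanged (`hasSteinerPacking_iff_packs`), and such subgraphs are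
easier to build and glue.

Upper bound for the sum: for a common $S$, packings of $G$ and of its complement unite to a packing
of $K_n$. A subgraph linking a $k$-set $S$ has at least $k-1$ edges inside $S$ or at least $k$ edges
touching $S$ (`Links.card_le`), and counting these edges in $K_n$ allows at most $n-\lceil
k/2\rceil$ members. In the second case of $M$ the graph $G$ is disconnected and contributes $0$,
while a suitable $S$ meets enough edges of $G$ to make the count for the complement strict.

Lower bound for the sum: $G$ or its complement is connected, which gives $1$. For few edges, $K_n$
minus $m$ edges still packs $l$ connected spanning subgraphs when $2l+1\le n$ and $2m+3l+2\le 2n$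
(`cliqueMinus_packs`), by induction on the number of vertices.

Upper bound for the product: the factors are at most $\delta(G)$ and $n-1-\Delta(G)$, and these are
compared with the average degree $2m/n$. Regular graphs lose one more in each factor, because two
adjacent vertices of minimum degree cannot both be saturated (`genEdgeConn_lt_of_adj`).

Sharpness comes from complete and empty graphs, stars, graphs containing a spanning star, the path
on four vertices, and cycles. The delicate packings are those in complements of stars
(`compl_star_packs`) and of cycles (`cycleCompl_packs`). -/

namespace SimpleGraph

variable {V : Type*}

/-! ### Packings of linking subgraphs -/

/-- All vertices of `S` lie in the same connected component of `H`. -/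
def Links (H : SimpleGraph V) (S : Finset V) : Prop :=
  ∀ x ∈ S, ∀ y ∈ S, H.Reachable x y

theorem Links.mono {H H' : SimpleGraph V} {S S' : Finset V} (h : H.Links S) (hH : H ≤ H')
    (hS : S' ⊆ S) : H'.Links S' :=
  fun x hx y hy => (h x (hS hx) y (hS hy)).mono hH

theorem links_of_root {H : SimpleGraph V} {S : Finset V} (r : V)
    (h : ∀ x ∈ S, H.Reachable x r) : H.Links S :=
  fun x hx y hy => (h x hx).trans (h y hy).symm

/-- `G` contains `l` pairwise edge-disjoint subgraphs, each of which links `S`. -/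
def Packs (G : SimpleGraph V) (S : Finset V) (l : ℕ) : Prop :=
  ∃ H : Fin l → SimpleGraph V, (∀ i, H i ≤ G) ∧ (∀ i j, i ≠ j → Disjoint (H i) (H j)) ∧
    ∀ i, (H i).Links S

/-- A spanning forest of `H` has the same components as `H`, so its component through `S` is the
required tree. -/
theorem exists_steinerTree_of_links {G H : SimpleGraph V} (hHG : H ≤ G) {S : Finset V}
    (hS : S.Nonempty) (hl : H.Links S) :
    ∃ T : G.Subgraph, IsSteinerTree G S T ∧ ∀ x y, T.Adj x y → H.Adj x y := by
  obtain ⟨s, hs⟩ := hS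
  obtain ⟨F, hFH, hF, hr⟩ := H.exists_isAcyclic_reachable_eq_le
  let c := F.connectedComponentMk s
  let T : G.Subgraph := ⟨c.supp, fun x y => x ∈ c.supp ∧ F.Adj x y, fun h => hHG (hFH h.2),
    fun h => h.1, ⟨fun x y h => ⟨(c.mem_supp_congr_adj h.2).1 h.1, h.2.symm⟩⟩⟩
  refine ⟨T, ⟨?_, ?_⟩, fun x y h => hFH h.2⟩
  · have ht : (F.induce c.supp).IsTree := ⟨c.connected_toSimpleGraph, hF.induce _⟩
    have e : T.coe = F.induce c.supp := by
      ext x y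
      exact ⟨fun h => h.2, fun h => ⟨x.2, h⟩⟩
    rw [e]
    exact ht
  · intro x hx
    have : F.Reachable x s := by rw [hr]; exact hl x hx s hs
    exact ConnectedComponent.sound this

theorem hasSteinerPacking_iff_packs {G : SimpleGraph V} {S : Finset V} (hS : S.Nonempty) {l : ℕ} :
    HasSteinerPacking G S l ↔ G.Packs S l := by
  constructor
  · rintro ⟨T, hT, hd⟩
    refine ⟨fun i => (T i).spanningCoe, fun i => (T i).spanningCoe_le, fun i j hij => ?_, ?_⟩
    · rw [disjoint_left]
      intro x y hx hy
      exact Set.disjoint_left.1 (hd i j hij) (show s(x, y) ∈ (T i).edgeSet from hx) hy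
    · intro i x hx y hy
      have := (hT i).1.1.preconnected ⟨x, (hT i).2 hx⟩ ⟨y, (hT i).2 hy⟩
      exact this.map ⟨Subtype.val, fun {a b} h => by simpa using h⟩
  · rintro ⟨H, hG, hd, hl⟩
    choose T hT hTH using fun i => exists_steinerTree_of_links (hG i) hS (hl i)
    refine ⟨T, hT, fun i j hij => Set.disjoint_left.2 fun e => ?_⟩
    induction e with
    | h x y =>
      intro hx hy
      exact disjoint_left.1 (hd i j hij) x y (hTH i x y hx) (hTH j x y hy)

theorem Packs.mono {G G' : SimpleGraph V} {S S' : Finset V} {l l' : ℕ} (h : G.Packs S l)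
    (hG : G ≤ G') (hS : S' ⊆ S) (hl : l' ≤ l) : G'.Packs S' l' := by
  obtain ⟨H, h1, h2, h3⟩ := h
  refine ⟨fun i => H (Fin.castLE hl i), fun i => (h1 _).trans hG, fun i j hij => h2 _ _ ?_,
    fun i => (h3 _).mono le_rfl hS⟩
  simpa using hij

theorem packs_zero (G : SimpleGraph V) (S : Finset V) : G.Packs S 0 :=
  ⟨fun i => i.elim0, fun i => i.elim0, fun i => i.elim0, fun i => i.elim0⟩

theorem packs_one {G : SimpleGraph V} {S : Finset V} (h : G.Links S) : G.Packs S 1 :=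
  ⟨fun _ => G, fun _ => le_rfl, fun i j hij => (hij (Subsingleton.elim i j)).elim, fun _ => h⟩

theorem packs_of_finset {ι : Type*} {G : SimpleGraph V} {S : Finset V} (I : Finset ι)
    (H : ι → SimpleGraph V) (hG : ∀ i ∈ I, H i ≤ G)
    (hd : ∀ i ∈ I, ∀ j ∈ I, i ≠ j → Disjoint (H i) (H j)) (hl : ∀ i ∈ I, (H i).Links S) :
    G.Packs S I.card := by
  refine ⟨fun i => H (I.equivFin.symm i), fun i => hG _ (I.equivFin.symm i).2,
    fun i j hij => hd _ (I.equivFin.symm i).2 _ (I.equivFin.symm j).2 ?_,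
    fun i => hl _ (I.equivFin.symm i).2⟩
  intro h
  exact hij (I.equivFin.symm.injective (Subtype.ext h))

theorem Packs.sup {G₁ G₂ : SimpleGraph V} {S : Finset V} {a b : ℕ} (h₁ : G₁.Packs S a)
    (h₂ : G₂.Packs S b) (hd : Disjoint G₁ G₂) : (G₁ ⊔ G₂).Packs S (a + b) := by
  obtain ⟨H, hG, hH, hl⟩ := h₁
  obtain ⟨K, kG, kH, kl⟩ := h₂
  refine ⟨Fin.append H K, ?_, ?_, ?_⟩
  · intro i
    induction i using Fin.addCases with
    | left i => simpa using (hG i).trans le_sup_left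
    | right i => simpa using (kG i).trans le_sup_right
  · intro i j
    induction i using Fin.addCases with
    | left i =>
      induction j using Fin.addCases with
      | left j => intro hij; simpa using hH i j (by rintro rfl; exact hij rfl)
      | right j => intro hij; simpa using hd.mono (hG i) (kG j)
    | right i =>
      induction j using Fin.addCases with
      | left j => intro hij; simpa using (hd.mono (hG j) (kG i)).symm
      | right j => intro hij; simpa using kH i j (by rintro rfl; exact hij rfl)
  · intro i
    induction i using Fin.addCases with
    | left i => simpa using hl i
    | right i => simpa using kl i

theorem Packs.succ {G G' K : SimpleGraph V} {S : Finset V} {l : ℕ} (h : G.Packs S l)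
    (hK : K.Links S) (hd : Disjoint G K) (hle : G ⊔ K ≤ G') : G'.Packs S (l + 1) :=
  (h.sup (packs_one hK) hd).mono hle subset_rfl le_rfl

/-- Deleting one edge destroys at most one member of a packing. -/
theorem Packs.delete_edge {G : SimpleGraph V} {S : Finset V} {l : ℕ} (h : G.Packs S (l + 1))
    (e : Sym2 V) : (G.deleteEdges {e}).Packs S l := by
  obtain ⟨H, hG, hd, hl⟩ := h
  by_cases he : ∃ i, e ∈ (H i).edgeSet
  · obtain ⟨i, hi⟩ := he
    refine ⟨fun j => H (i.succAbove j), fun j x y hxy => ?_,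
      fun j k hjk => hd _ _ (fun h => hjk (Fin.succAbove_right_injective h)), fun j => hl _⟩
    rw [deleteEdges_adj]
    refine ⟨hG _ hxy, ?_⟩
    rintro rfl
    exact disjoint_left.1 (hd _ _ (Fin.succAbove_ne i j)) x y hxy hi
  · push Not at he
    refine ⟨fun j => H j.castSucc, fun j x y hxy => ?_,
      fun j k hjk => hd _ _ (by simpa using hjk), fun j => hl _⟩
    rw [deleteEdges_adj]
    refine ⟨hG _ hxy, ?_⟩
    rintro rfl
    exact he _ hxy

/-- Injectivity is needed only on the set `U` of non-isolated vertices; this lets packings be built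
on `ℕ` and carried to `Fin n` by rotation. -/
theorem Packs.map {W : Type*} {G : SimpleGraph V} {G' : SimpleGraph W} {S : Finset V}
    {S' : Finset W} {l : ℕ} (h : G.Packs S l) (f : V → W) (U : Set V) (hf : Set.InjOn f U)
    (hU : ∀ x y, G.Adj x y → x ∈ U)
    (hG : ∀ x y, G.Adj x y → G'.Adj (f x) (f y)) (hS : ∀ y ∈ S', ∃ x ∈ S, f x = y) :
    G'.Packs S' l := by
  obtain ⟨H, hH, hd, hl⟩ := h
  let K : Fin l → SimpleGraph W := fun i =>
    ⟨fun a b => ∃ x y, (H i).Adj x y ∧ f x = a ∧ f y = b,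
      ⟨by rintro a b ⟨x, y, h, rfl, rfl⟩; exact ⟨y, x, h.symm, rfl, rfl⟩⟩,
      ⟨by
        rintro a ⟨x, y, h, rfl, h'⟩
        have := hG x y (hH i h)
        rw [h'] at this
        exact this.ne rfl⟩⟩
  refine ⟨K, ?_, ?_, ?_⟩
  · rintro i a b ⟨x, y, h, rfl, rfl⟩
    exact hG x y (hH i h)
  · intro i j hij
    rw [disjoint_left]
    rintro a b ⟨x, y, h, rfl, rfl⟩ ⟨x', y', h', h1, h2⟩
    have e1 := hf (hU _ _ (hH j h')) (hU _ _ (hH i h)) h1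
    have e2 := hf (hU _ _ (hH j h'.symm)) (hU _ _ (hH i h.symm)) h2
    subst e1 e2
    exact disjoint_left.1 (hd i j hij) _ _ h h'
  · intro i a ha b hb
    obtain ⟨x, hx, rfl⟩ := hS a ha
    obtain ⟨y, hy, rfl⟩ := hS b hb
    exact (hl i x hx y hy).map (⟨f, fun {u v} h => ⟨u, v, h, rfl, rfl⟩⟩ : H i →g K i)

/-! ### Stars, and extending a packing by a vertex -/

/-- The star with centre `u` and set of leaves `A`. -/
def starOn (u : V) (A : Finset V) : SimpleGraph V :=
  fromRel fun x y => x = u ∧ y ∈ A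

theorem starOn_adj {u : V} {A : Finset V} {x y : V} :
    (starOn u A).Adj x y ↔ x ≠ y ∧ ((x = u ∧ y ∈ A) ∨ (y = u ∧ x ∈ A)) := by
  simp [starOn]

theorem starOn_adj_center {u : V} {A : Finset V} {y : V} (hu : u ∉ A) (hy : y ∈ A) :
    (starOn u A).Adj u y := by
  rw [starOn_adj]
  exact ⟨fun h => hu (h ▸ hy), Or.inl ⟨rfl, hy⟩⟩

theorem starOn_links (u : V) (A : Finset V) : (starOn u A).Links A := by
  refine links_of_root u fun x hx => ?_
  by_cases h : x = u
  · rw [h]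
  · exact Adj.reachable (starOn_adj.2 ⟨h, Or.inr ⟨rfl, hx⟩⟩)

/-- Common core of `Packs.attach` and `Packs.pinch`: away from `u` the members are disjoint because
the `B i` are, and at `u` because the leaf sets `N i` are. -/
theorem packs_of_new_vertex [DecidableEq V] {G G' : SimpleGraph V} {S U : Finset V} {l : ℕ}
    {u : V} (hu : ∀ x, ¬ G.Adj u x) (huU : u ∉ U) (B : Fin l → SimpleGraph V)
    (hB : ∀ i, B i ≤ G) (hd : ∀ i j, i ≠ j → Disjoint (B i) (B j)) (N : Fin l → Finset V)
    (hN : ∀ i, N i ⊆ U) (hNd : ∀ i j, i ≠ j → Disjoint (N i) (N j))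
    (hl : ∀ i, (B i ⊔ starOn u (N i)).Links S) (hle : G ⊔ starOn u U ≤ G') : G'.Packs S l := by
  refine ⟨fun i => B i ⊔ starOn u (N i), fun i => ?_, fun i j hij => ?_, hl⟩
  · refine le_trans (sup_le_sup (hB i) fun x y hxy => ?_) hle
    rw [starOn_adj] at hxy ⊢
    exact ⟨hxy.1, hxy.2.imp (fun h => ⟨h.1, hN i h.2⟩) fun h => ⟨h.1, hN i h.2⟩⟩
  · have key : ∀ i j, Disjoint (B i) (starOn u (N j)) := by
      intro i j
      rw [disjoint_left]
      intro x y hx hy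
      rcases (starOn_adj.1 hy).2 with ⟨rfl, -⟩ | ⟨rfl, -⟩
      · exact hu _ (hB i hx)
      · exact hu _ (hB i hx.symm)
    rw [disjoint_sup_left, disjoint_sup_right, disjoint_sup_right]
    refine ⟨⟨hd i j hij, key i j⟩, (key j i).symm, ?_⟩
    rw [disjoint_left]
    intro x y hx hy
    have h := Finset.disjoint_left.1 (hNd i j hij)
    rcases (starOn_adj.1 hx).2 with ⟨rfl, h1⟩ | ⟨rfl, h1⟩ <;>
      rcases (starOn_adj.1 hy).2 with ⟨h3, h2⟩ | ⟨h3, h2⟩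
    · exact h h1 h2
    · exact huU (hN _ h2)
    · exact huU (hN _ h2)
    · exact h h1 h2

/-- Add a new vertex `u` as a leaf to all members of a packing, along edges from `u` to `U`. -/
theorem Packs.attach [DecidableEq V] {G G' : SimpleGraph V} {S U : Finset V} {l : ℕ}
    (h : G.Packs S l) {u : V} (hu : ∀ x, ¬ G.Adj u x) (hUS : U ⊆ S) (huS : u ∉ S)
    (hU : l ≤ U.card) (hle : G ⊔ starOn u U ≤ G') : G'.Packs (insert u S) l := by
  obtain ⟨H, hG, hd, hl⟩ := h
  obtain ⟨φ⟩ : Nonempty (Fin l ↪ U) :=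
    Function.Embedding.nonempty_of_card_le (by simpa using hU)
  have hφ : ∀ i, u ≠ φ i := fun i h => huS (h ▸ hUS (φ i).2)
  refine packs_of_new_vertex hu (fun h => huS (hUS h)) H hG hd (fun i => {(φ i : V)})
    (fun i => by simp) (fun i j hij => ?_) (fun i => ?_) hle
  · rw [Finset.disjoint_singleton]
    exact fun h => hij (φ.injective (Subtype.ext h))
  · refine links_of_root (φ i : V) fun x hx => ?_
    rcases Finset.mem_insert.1 hx with rfl | hx
    · exact Adj.reachable (Or.inr (starOn_adj.2 ⟨hφ i, by simp⟩))
    · exact (hl i x hx _ (hUS (φ i).2)).mono le_sup_left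

/-- Subdivide the edge `xy` by a new vertex `u` and add `u` as a leaf to the members of the packing
that do not contain `xy`. -/
theorem Packs.pinch [DecidableEq V] {G G' : SimpleGraph V} {S U : Finset V} {l : ℕ} {x y : V}
    (h : (G ⊔ edge x y).Packs S l) (hxy : x ≠ y) (hl0 : 0 < l) {u : V} (hu : ∀ x, ¬ G.Adj u x)
    (hUS : U ⊆ S) (huS : u ∉ S) (hU : l + 1 ≤ U.card) (hx : x ∈ U) (hy : y ∈ U)
    (hle : G ⊔ starOn u U ≤ G') : G'.Packs (insert u S) l := by
  obtain ⟨H, hG, hd, hl⟩ := h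
  -- By disjointness at most one member uses `xy`; if none does, any index may play its role, which
  -- needs `0 < l`.
  obtain ⟨i₀, hi₀⟩ : ∃ i₀, ∀ j, j ≠ i₀ → ¬ (H j).Adj x y := by
    by_cases hc : ∃ i, (H i).Adj x y
    · obtain ⟨i, hi⟩ := hc
      exact ⟨i, fun j hj h => disjoint_left.1 (hd j i hj) x y h hi⟩
    · push Not at hc
      exact ⟨⟨0, hl0⟩, fun j _ => hc j⟩
  obtain ⟨φ₀⟩ : Nonempty (Fin l ↪ U.erase y) :=
    Function.Embedding.nonempty_of_card_le (by
      have := Finset.card_erase_of_mem hy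
      simp only [Fintype.card_fin, Fintype.card_coe]; omega)
  let x' : U.erase y := ⟨x, Finset.mem_erase.2 ⟨hxy, hx⟩⟩
  -- The swap gives `x` to member `i₀`. This member also needs `y`, so `y` is withheld from all the
  -- others; hence the requirement `l + 1 ≤ U.card`.
  let φ := φ₀.trans (Equiv.swap x' (φ₀ i₀)).toEmbedding
  have hφi : φ i₀ = x' := by simp [φ]
  have hφU : ∀ i, (φ i : V) ∈ U := fun i => Finset.mem_of_mem_erase (φ i).2
  have hφy : ∀ i, (φ i : V) ≠ y := fun i => Finset.ne_of_mem_erase (φ i).2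
  have huU : u ∉ U := fun h => huS (hUS h)
  let N : Fin l → Finset V := fun i => if i = i₀ then {x, y} else {(φ i : V)}
  have hcenter : ∀ i, (φ i : V) ∈ N i := by
    intro i
    simp only [N]
    split_ifs with h
    · subst h; simp [hφi, x']
    · simp
  have hN : ∀ i, N i ⊆ U := by
    intro i a ha
    simp only [N] at ha
    split_ifs at ha
    · rcases Finset.mem_insert.1 ha with rfl | ha
      · exact hx
      · rw [Finset.mem_singleton.1 ha]; exact hy
    · rw [Finset.mem_singleton.1 ha]; exact hφU i
  have hadj : ∀ i a, a ∈ N i → (starOn u (N i)).Adj a u := fun i a ha =>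
    (starOn_adj_center (fun h => huU (hN i h)) ha).symm
  refine packs_of_new_vertex (G := G) hu huU (fun i => (H i).deleteEdges {s(x, y)})
    (fun i => ?_) (fun i j hij => (hd i j hij).mono (deleteEdges_le _) (deleteEdges_le _)) N hN
    (fun i j hij => ?_) (fun i => ?_) hle
  · intro a b hab
    rw [deleteEdges_adj] at hab
    rcases hG i hab.1 with h | h
    · exact h
    · refine (hab.2 ?_).elim
      rw [edge_adj] at h
      rcases h.1 with ⟨rfl, rfl⟩ | ⟨rfl, rfl⟩
      · rfl
      · exact Sym2.eq_swap
  · have hne : (φ i : V) ≠ φ j := fun h => hij (φ.injective (Subtype.ext h))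
    simp only [N]
    rcases eq_or_ne i i₀ with rfl | hi
    · rw [hφi] at hne
      rw [if_pos rfl, if_neg hij.symm]
      simpa using ⟨hne.symm, hφy j⟩
    · rcases eq_or_ne j i₀ with rfl | hj
      · rw [hφi] at hne
        rw [if_pos rfl, if_neg hi]
        simpa using ⟨hne, hφy i⟩
      · rw [if_neg hi, if_neg hj]
        simpa using hne
  · have hstep : ∀ a b, (H i).Adj a b →
        ((H i).deleteEdges {s(x, y)} ⊔ starOn u (N i)).Reachable a b := by
      intro a b hab
      by_cases he : s(a, b) = s(x, y)
      · have hi : i = i₀ := by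
          by_contra hi
          refine hi₀ i hi ?_
          rw [← mem_edgeSet, ← he]
          exact hab
        have hxN : x ∈ N i := by simp [N, hi]
        have hyN : y ∈ N i := by simp [N, hi]
        have h1 := ((hadj i x hxN).reachable.trans (hadj i y hyN).symm.reachable).mono
          (le_sup_right (a := (H i).deleteEdges {s(x, y)}))
        rcases Sym2.eq_iff.1 he with ⟨rfl, rfl⟩ | ⟨rfl, rfl⟩
        · exact h1
        · exact h1.symm
      · exact Adj.reachable (Or.inl (deleteEdges_adj.2 ⟨hab, he⟩))
    have hreach : ∀ a b, (H i).Reachable a b →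
        ((H i).deleteEdges {s(x, y)} ⊔ starOn u (N i)).Reachable a b := by
      rintro a b ⟨w⟩
      induction w with
      | nil => rfl
      | cons h _ ih => exact (hstep _ _ h).trans ih
    refine links_of_root (φ i : V) fun a ha => ?_
    rcases Finset.mem_insert.1 ha with rfl | ha
    · exact ((hadj i _ (hcenter i)).symm.reachable).mono le_sup_right
    · exact hreach _ _ (hl i a ha _ (hUS (hφU i)))

/-! ### Packings in nearly complete graphs -/

/-- The complete graph on `S` without the edges in `F`. -/
def cliqueMinus (S : Finset V) (F : Finset (Sym2 V)) : SimpleGraph V where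
  Adj x y := x ≠ y ∧ x ∈ S ∧ y ∈ S ∧ s(x, y) ∉ F
  symm := ⟨fun _ _ h => ⟨h.1.symm, h.2.2.1, h.2.1, Sym2.eq_swap ▸ h.2.2.2⟩⟩
  loopless := ⟨fun _ h => h.1 rfl⟩

theorem starOn_mono {u : V} {A B : Finset V} (h : A ⊆ B) : starOn u A ≤ starOn u B := by
  intro x y hxy
  rw [starOn_adj] at hxy ⊢
  exact ⟨hxy.1, hxy.2.imp (fun k => ⟨k.1, h k.2⟩) fun k => ⟨k.1, h k.2⟩⟩

theorem cliqueMinus_adj {S : Finset V} {F : Finset (Sym2 V)} {x y : V} :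
    (cliqueMinus S F).Adj x y ↔ x ≠ y ∧ x ∈ S ∧ y ∈ S ∧ s(x, y) ∉ F := Iff.rfl

theorem cliqueMinus_mono {S S' : Finset V} {F F' : Finset (Sym2 V)} (hS : S ⊆ S') (hF : F' ⊆ F) :
    cliqueMinus S F ≤ cliqueMinus S' F' :=
  fun _ _ h => ⟨h.1, hS h.2.1, hS h.2.2.1, fun k => h.2.2.2 (hF k)⟩

/-- Given a packing on `Q ∪ {u}` with all edges at `u` leading to `U`, add a vertex `v` to its
members by edges to `W`, and add a new member consisting of the edge `uv`, the edges from `u` to `W`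
and the edges from `v` to the rest of `Q`. -/
theorem packs_add_pair [DecidableEq V] {G G' : SimpleGraph V} {Q U W : Finset V} {u v : V} {l : ℕ}
    (hG : ∀ a b, G.Adj a b → a ∈ Q) (hu : u ∉ Q) (hv : v ∉ Q) (huv : u ≠ v)
    (h : (G ⊔ starOn u U).Packs (insert u Q) l) (hU : U ⊆ Q) (hW : W ⊆ Q) (hUW : Disjoint U W)
    (hl : l ≤ W.card)
    (hle : G ⊔ starOn u (insert v (U ∪ W)) ⊔ starOn v Q ≤ G') :
    G'.Packs (insert v (insert u Q)) (l + 1) := by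
  have hUW' := Finset.disjoint_left.1 hUW
  have h1 : (G ⊔ starOn u U ⊔ starOn v W).Packs (insert v (insert u Q)) l := by
    refine h.attach (u := v) (U := W) (fun x hx => ?_) (hW.trans (Finset.subset_insert _ _))
      ?_ hl le_rfl
    · rcases hx with hx | hx
      · exact hv (hG _ _ hx)
      · rcases (starOn_adj.1 hx).2 with ⟨h, -⟩ | ⟨-, h⟩
        · exact huv h.symm
        · exact hv (hU h)
    · simp [hv, huv.symm]
  refine h1.succ (K := starOn u (insert v W) ⊔ starOn v (Q \ W)) ?_ ?_ ?_
  · have huv' : (starOn u (insert v W) ⊔ starOn v (Q \ W)).Reachable v u := by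
      refine Adj.reachable (Or.inl (starOn_adj_center ?_ (Finset.mem_insert_self _ _)).symm)
      rw [Finset.mem_insert, not_or]
      exact ⟨huv, fun h => hu (hW h)⟩
    refine links_of_root u fun x hx => ?_
    rcases Finset.mem_insert.1 hx with rfl | hx
    · exact huv'
    · rcases Finset.mem_insert.1 hx with rfl | hxQ
      · rfl
      · by_cases hxW : x ∈ W
        · refine Adj.reachable (Or.inl (starOn_adj.2 ⟨?_, Or.inr ⟨rfl, ?_⟩⟩))
          · rintro rfl; exact hu hxQ
          · exact Finset.mem_insert_of_mem hxW
        · refine Reachable.trans (Adj.reachable (Or.inr (starOn_adj.2 ⟨?_, Or.inr ⟨rfl, ?_⟩⟩))) huv'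
          · rintro rfl; exact hv hxQ
          · exact Finset.mem_sdiff.2 ⟨hxQ, hxW⟩
  · rw [disjoint_left]
    intro x y hx hy
    have hGu : ∀ x, ¬ G.Adj u x := fun x hx => hu (hG _ _ hx)
    have hGv : ∀ x, ¬ G.Adj v x := fun x hx => hv (hG _ _ hx)
    have hs := fun a b (h : G.Adj a b) => h.symm
    simp only [sup_adj, starOn_adj, Finset.mem_insert, Finset.mem_sdiff] at hx hy
    grind
  · refine le_trans (sup_le (sup_le (sup_le ?_ ?_) ?_) (sup_le ?_ ?_)) hle
    · exact le_sup_left.trans le_sup_left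
    · refine le_trans (starOn_mono ?_) (le_sup_right.trans le_sup_left)
      exact Finset.subset_union_left.trans (Finset.subset_insert _ _)
    · exact (starOn_mono hW).trans le_sup_right
    · refine le_trans (starOn_mono ?_) (le_sup_right.trans le_sup_left)
      exact Finset.insert_subset_insert _ Finset.subset_union_right
    · exact (starOn_mono Finset.sdiff_subset).trans le_sup_right

theorem cliqueMinus_erase_le [DecidableEq V] {Q : Finset V} {F : Finset (Sym2 V)} {x y : V} :
    cliqueMinus Q (F.erase s(x, y)) ≤ cliqueMinus Q F ⊔ edge x y := by
  rintro a b ⟨h1, h2, h3, h4⟩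
  by_cases h : s(a, b) = s(x, y)
  · right
    rw [edge_adj]
    exact ⟨by simpa using h, h1⟩
  · left
    exact ⟨h1, h2, h3, fun h' => h4 (Finset.mem_erase.2 ⟨h, h'⟩)⟩

/-- A complete graph on `2l + 1` vertices with at most `l / 2` edges removed contains `l` disjoint
connected spanning subgraphs. -/
theorem cliqueMinus_packs_half [DecidableEq V] : ∀ (l : ℕ) (S : Finset V) (F : Finset (Sym2 V)),
    S.card = 2 * l + 1 → 2 * F.card ≤ l → (cliqueMinus S F).Packs S l := by
  intro l
  induction l with
  | zero => exact fun S F _ _ => packs_zero _ _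
  | succ l ih =>
    intro S F hS hF
    have ht : (F.biUnion Sym2.toFinset).card ≤ F.card * 2 := by
      refine Finset.card_biUnion_le_card_mul _ _ _ fun e _ => ?_
      rw [Sym2.card_toFinset]
      split_ifs <;> omega
    -- The removed edges touch at most $2|F|\le l+1$ of the $2l+3$ vertices, so two vertices `u`,
    -- `v` keep all their edges.
    have hC : 1 < (S \ F.biUnion Sym2.toFinset).card := by
      have := Finset.le_card_sdiff (F.biUnion Sym2.toFinset) S
      omega
    obtain ⟨u, hu, v, hv, huv⟩ := Finset.one_lt_card.1 hC
    simp only [Finset.mem_sdiff, Finset.mem_biUnion, Sym2.mem_toFinset, not_exists, not_and]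
      at hu hv
    obtain ⟨huS, huF⟩ := hu
    obtain ⟨hvS, hvF⟩ := hv
    have huF' : ∀ a, s(u, a) ∉ F := fun a h => huF _ h (Sym2.mem_mk_left _ _)
    have hvF' : ∀ a, s(v, a) ∉ F := fun a h => hvF _ h (Sym2.mem_mk_left _ _)
    have hSQ : insert v (insert u ((S.erase u).erase v)) = S := by
      ext a
      simp only [Finset.mem_insert, Finset.mem_erase]
      grind
    have hQ : ((S.erase u).erase v).card = 2 * l + 1 := by
      rw [Finset.card_erase_of_mem (Finset.mem_erase.2 ⟨huv.symm, hvS⟩),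
        Finset.card_erase_of_mem huS]
      omega
    have hQS : (S.erase u).erase v ⊆ S := (Finset.erase_subset _ _).trans (Finset.erase_subset _ _)
    have huQ : u ∉ (S.erase u).erase v := by simp
    have hvQ : v ∉ (S.erase u).erase v := by simp
    generalize (S.erase u).erase v = Q at hSQ hQ hQS huQ hvQ
    -- The induction hypothesis tolerates $2|F|\le l$, but only $2|F|\le l+1$ is known. One removed
    -- edge is therefore restored, and then eliminated by subdividing it with `u`; this costs one
    -- extra edge at `u`, whence $|U|=l+1$.
    obtain ⟨U, hUQ, hU, hp⟩ : ∃ U ⊆ Q, U.card = l + 1 ∧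
        (cliqueMinus Q F ⊔ starOn u U).Packs (insert u Q) l := by
      have hGu : ∀ x, ¬ (cliqueMinus Q F).Adj u x := fun x hx => huQ hx.2.1
      have simple : (cliqueMinus Q F).Packs Q l → ∃ U ⊆ Q, U.card = l + 1 ∧
          (cliqueMinus Q F ⊔ starOn u U).Packs (insert u Q) l := by
        intro h
        obtain ⟨U, hUQ, hU⟩ := Finset.exists_subset_card_eq (show l + 1 ≤ Q.card by omega)
        exact ⟨U, hUQ, hU, h.attach hGu hUQ huQ (by omega) le_rfl⟩
      rcases F.eq_empty_or_nonempty with rfl | ⟨e, he⟩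
      · exact simple (ih Q ∅ hQ (by simp))
      · have hFc := Finset.card_erase_of_mem he
        have hF0 := Finset.card_pos.2 ⟨e, he⟩
        have h := ih Q (F.erase e) hQ (by omega)
        induction e with
        | h x y =>
          by_cases hxy : x ≠ y ∧ x ∈ Q ∧ y ∈ Q
          · obtain ⟨U, hxU, hUQ, hU⟩ := Finset.exists_subsuperset_card_eq
              (show {x, y} ⊆ Q by
                rw [Finset.insert_subset_iff, Finset.singleton_subset_iff]; exact hxy.2)
              (show ({x, y} : Finset V).card ≤ l + 1 from Finset.card_le_two.trans (by omega))
              (show l + 1 ≤ Q.card by omega)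
            exact ⟨U, hUQ, hU, (h.mono cliqueMinus_erase_le subset_rfl le_rfl).pinch hxy.1
              (by omega) hGu hUQ huQ (by omega) (hxU (by simp)) (hxU (by simp)) le_rfl⟩
          · refine simple (h.mono ?_ subset_rfl le_rfl)
            rintro a b ⟨h1, h2, h3, h4⟩
            refine ⟨h1, h2, h3, fun h' => h4 (Finset.mem_erase.2 ⟨fun h'' => hxy ?_, h'⟩)⟩
            rcases Sym2.eq_iff.1 h'' with ⟨rfl, rfl⟩ | ⟨rfl, rfl⟩
            · exact ⟨h1, h2, h3⟩
            · exact ⟨h1.symm, h3, h2⟩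
    rw [← hSQ]
    -- Here $W=Q\setminus U$ has exactly $(2l+1)-(l+1)=l$ vertices, just enough to attach `v` to the
    -- $l$ old members.
    refine packs_add_pair (G := cliqueMinus Q F) (fun a b h => h.2.1) huQ hvQ huv hp hUQ
      Finset.sdiff_subset Finset.disjoint_sdiff (by rw [Finset.card_sdiff_of_subset hUQ]; omega) ?_
    refine sup_le (sup_le (cliqueMinus_mono (fun a ha => by simp [ha]) subset_rfl) ?_) ?_
    · intro a b h
      rw [starOn_adj, Finset.union_sdiff_of_subset hUQ] at h
      refine ⟨h.1, ?_, ?_, ?_⟩ <;> rcases h.2 with ⟨rfl, hb⟩ | ⟨rfl, hb⟩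
      all_goals first | exact huF' _ | (rw [Sym2.eq_swap]; exact huF' _) | skip
      all_goals simp only [Finset.mem_insert] at hb ⊢; tauto
    · intro a b h
      rw [starOn_adj] at h
      refine ⟨h.1, ?_, ?_, ?_⟩ <;> rcases h.2 with ⟨rfl, hb⟩ | ⟨rfl, hb⟩
      all_goals first | exact hvF' _ | (rw [Sym2.eq_swap]; exact hvF' _) | skip
      all_goals simp only [Finset.mem_insert]; tauto

/-- A complete graph on `n` vertices with at most `m` edges removed contains `l` disjoint connected
spanning subgraphs if `n = 2l + 1 + t` and `2m ≤ l + 2t`. -/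
theorem cliqueMinus_packs [DecidableEq V] (l : ℕ) : ∀ (t : ℕ) (S : Finset V) (F : Finset (Sym2 V)),
    S.card = 2 * l + 1 + t → 2 * F.card ≤ l + 2 * t → (cliqueMinus S F).Packs S l := by
  intro t
  induction t with
  | zero => exact fun S F hS hF => cliqueMinus_packs_half l S F hS hF
  | succ t ih =>
    intro S F hS hF
    -- Deleting an end of a removed edge lowers `t` by one and takes that edge out of consideration,
    -- as the bound $l+2t$ on $2|F|$ requires.
    obtain ⟨u, huS, F', hF', hF'c, hFF'⟩ : ∃ u ∈ S, ∃ F' ⊆ F, 2 * F'.card ≤ l + 2 * t ∧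
        cliqueMinus (S.erase u) F' ≤ cliqueMinus (S.erase u) F := by
      rcases F.eq_empty_or_nonempty with rfl | ⟨e, he⟩
      · obtain ⟨u, hu⟩ := Finset.card_pos.1 (show 0 < S.card by omega)
        exact ⟨u, hu, ∅, subset_rfl, by simp, le_rfl⟩
      · have hFc := Finset.card_erase_of_mem he
        obtain ⟨u, hu, hue⟩ : ∃ u ∈ S, ∀ w ∈ S, w ∈ e → u ∈ e := by
          by_cases h : ∃ w ∈ S, w ∈ e
          · obtain ⟨w, hw, hwe⟩ := h
            exact ⟨w, hw, fun _ _ _ => hwe⟩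
          · push Not at h
            obtain ⟨u, hu⟩ := Finset.card_pos.1 (show 0 < S.card by omega)
            exact ⟨u, hu, fun w hw hwe => (h w hw hwe).elim⟩
        refine ⟨u, hu, F.erase e, Finset.erase_subset _ _, by omega, ?_⟩
        rintro a b ⟨h1, h2, h3, h4⟩
        refine ⟨h1, h2, h3, fun h' => h4 (Finset.mem_erase.2 ⟨?_, h'⟩)⟩
        rintro rfl
        rw [Finset.mem_erase] at h2 h3
        have := hue a h2.2 (Sym2.mem_mk_left _ _)
        rw [Sym2.mem_iff] at this
        rcases this with rfl | rfl
        · exact h2.1 rfl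
        · exact h3.1 rfl
    have hQ := Finset.card_erase_of_mem huS
    have h := (ih (S.erase u) F' (by omega) hF'c).mono hFF' subset_rfl le_rfl
    -- At least $(2l+1+t)-|F|\ge l$ edges survive at `u`, so it can be a leaf of every member.
    have hU : l ≤ ((S.erase u).filter fun a => s(u, a) ∉ F).card := by
      have h1 := Finset.card_filter_add_card_filter_not (s := S.erase u) (fun a => s(u, a) ∉ F)
      have h2 : ((S.erase u).filter fun a => ¬ s(u, a) ∉ F).card ≤ F.card := by
        refine Finset.card_le_card_of_injOn (fun a => s(u, a)) (fun a ha => ?_) ?_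
        · simpa using (Finset.mem_filter.1 ha).2
        · intro a _ b _ hab
          exact Sym2.congr_right.1 hab
      omega
    have h' := h.attach (u := u) (fun x hx => by simpa using hx.2.1) (Finset.filter_subset _ _)
      (by simp) hU le_rfl
    rw [Finset.insert_erase huS] at h'
    refine h'.mono (sup_le (cliqueMinus_mono (Finset.erase_subset _ _) subset_rfl) ?_) subset_rfl
      le_rfl
    intro a b hab
    rw [starOn_adj, Finset.mem_filter, Finset.mem_filter, Finset.mem_erase, Finset.mem_erase] at hab
    rcases hab with ⟨h1, ⟨rfl, h2, h3⟩ | ⟨rfl, h2, h3⟩⟩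
    · exact ⟨h1, huS, h2.2, h3⟩
    · exact ⟨h1, h2.2, huS, Sym2.eq_swap ▸ h3⟩

theorem mem_starEdges [DecidableEq V] {A : Finset V} {c x y : V} :
    s(x, y) ∈ A.image (fun a => s(c, a)) ↔ (x = c ∧ y ∈ A) ∨ (y = c ∧ x ∈ A) := by
  rw [Finset.mem_image]
  constructor
  · rintro ⟨a, ha, h⟩
    rcases Sym2.eq_iff.1 h with ⟨rfl, rfl⟩ | ⟨rfl, rfl⟩
    · exact Or.inl ⟨rfl, ha⟩
    · exact Or.inr ⟨rfl, ha⟩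
  · rintro (⟨rfl, h⟩ | ⟨rfl, h⟩)
    · exact ⟨y, h, rfl⟩
    · exact ⟨x, h, Sym2.eq_swap⟩

theorem starOn_le_cliqueMinus [DecidableEq V] {S A B : Finset V} {c u : V} (hu : u ∈ S)
    (hB : B ⊆ S) (h : ∀ b ∈ B, ¬ (u = c ∧ b ∈ A) ∧ ¬ (b = c ∧ u ∈ A)) :
    starOn u B ≤ cliqueMinus S (A.image fun a => s(c, a)) := by
  intro x y hxy
  rw [starOn_adj] at hxy
  rw [cliqueMinus_adj, mem_starEdges]
  rcases hxy with ⟨h1, ⟨rfl, h2⟩ | ⟨rfl, h2⟩⟩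
  · exact ⟨h1, hu, hB h2, by have := h _ h2; tauto⟩
  · exact ⟨h1, hB h2, hu, by have := h _ h2; tauto⟩

/-- A complete graph on `2p + 1` vertices with at most `p` edges at one vertex removed contains `p`
disjoint connected spanning subgraphs. -/
theorem cliqueMinus_star_packs [DecidableEq V] : ∀ (p : ℕ) (S A : Finset V) (c : V),
    S.card = 2 * p + 1 → c ∈ S → A ⊆ S.erase c → A.card ≤ p →
      (cliqueMinus S (A.image fun a => s(c, a))).Packs S p := by
  intro p
  induction p with
  | zero => exact fun S A c _ _ _ _ => packs_zero _ _
  | succ p ih =>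
    intro S A₀ c hS hc hA₀ hA₀c
    have hSc := Finset.card_erase_of_mem hc
    -- It suffices to remove exactly $p+1$ edges. The result is then tight: every remaining edge is
    -- needed.
    obtain ⟨A, hA₀A, hA, hAc⟩ := Finset.exists_subsuperset_card_eq hA₀ hA₀c (by omega)
    refine Packs.mono ?_ (cliqueMinus_mono subset_rfl (Finset.image_subset_image hA₀A)) subset_rfl
      le_rfl
    obtain ⟨u, hu⟩ := Finset.card_pos.1 (show 0 < A.card by omega)
    obtain ⟨v, hv⟩ := Finset.card_pos.1 (show 0 < ((S.erase c) \ A).card by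
      rw [Finset.card_sdiff_of_subset hA]; omega)
    obtain ⟨hvS, hvA⟩ := Finset.mem_sdiff.1 hv
    obtain ⟨hvc, hvS⟩ := Finset.mem_erase.1 hvS
    obtain ⟨huc, huS⟩ := Finset.mem_erase.1 (hA hu)
    have huv : u ≠ v := fun h => hvA (h ▸ hu)
    have hSQ : insert v (insert u ((S.erase u).erase v)) = S := by
      ext a
      simp only [Finset.mem_insert, Finset.mem_erase]
      grind
    have hQ : ((S.erase u).erase v).card = 2 * p + 1 := by
      rw [Finset.card_erase_of_mem (Finset.mem_erase.2 ⟨huv.symm, hvS⟩),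
        Finset.card_erase_of_mem huS]
      omega
    have hmQ : ∀ a, a ∈ (S.erase u).erase v ↔ a ≠ v ∧ a ≠ u ∧ a ∈ S := fun a => by
      simp only [Finset.mem_erase]
    generalize (S.erase u).erase v = Q at hSQ hQ hmQ
    have huQ : u ∉ Q := by rw [hmQ]; tauto
    have hvQ : v ∉ Q := by rw [hmQ]; tauto
    have hcQ : c ∈ Q := by rw [hmQ]; exact ⟨hvc.symm, huc.symm, hc⟩
    have hQS : Q ⊆ S := fun a ha => ((hmQ a).1 ha).2.2
    have h := ih Q (A.erase u) c hQ hcQ (fun a ha => by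
      obtain ⟨h1, h2⟩ := Finset.mem_erase.1 ha
      obtain ⟨h3, h4⟩ := Finset.mem_erase.1 (hA h2)
      refine Finset.mem_erase.2 ⟨h3, (hmQ a).2 ⟨?_, h1, h4⟩⟩
      rintro rfl
      exact hvA h2) (by rw [Finset.card_erase_of_mem hu]; omega)
    have hQc := Finset.card_erase_of_mem hcQ
    -- Since `uc` is removed, the old and the new members share the $2p$ edges from `u` to
    -- $Q\setminus\{c\}$, half each. In the new member `c` is reached from `v`, whose edges are all
    -- present.
    obtain ⟨U, hU, hUc⟩ := Finset.exists_subset_card_eq (show p ≤ (Q.erase c).card by omega)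
    have hUQ : U ⊆ Q := hU.trans (Finset.erase_subset _ _)
    have h' := h.attach (u := u) (fun x hx => huQ hx.2.1) hUQ huQ hUc.ge le_rfl
    rw [← hSQ]
    refine packs_add_pair (G := cliqueMinus Q ((A.erase u).image fun a => s(c, a)))
      (W := Q.erase c \ U) (fun a b h => h.2.1) huQ hvQ huv h' hUQ
      (Finset.sdiff_subset.trans (Finset.erase_subset _ _)) Finset.disjoint_sdiff
      (by rw [Finset.card_sdiff_of_subset hU]; omega) ?_
    rw [hSQ, Finset.union_sdiff_of_subset hU]
    refine sup_le (sup_le ?_ (starOn_le_cliqueMinus huS ?_ ?_)) (starOn_le_cliqueMinus hvS hQS ?_)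
    · rintro x y ⟨h1, h2, h3, h4⟩
      refine ⟨h1, hQS h2, hQS h3, ?_⟩
      rw [mem_starEdges] at h4 ⊢
      rw [Finset.mem_erase, Finset.mem_erase] at h4
      have hxu := ((hmQ x).1 h2).2.1
      have hyu := ((hmQ y).1 h3).2.1
      tauto
    · rw [Finset.insert_subset_iff]
      exact ⟨hvS, (Finset.erase_subset _ _).trans hQS⟩
    · intro b hb
      rw [Finset.mem_insert, Finset.mem_erase] at hb
      refine ⟨fun h => huc h.1, fun h => ?_⟩
      rcases hb with rfl | hb
      · exact hvc h.1
      · exact hb.1 h.1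
    · intro b hb
      exact ⟨fun h => hvc h.1, fun h => hvA h.2⟩

/-- Remove a vertex `w` and apply the star version to the other $2q+1$ vertices: `w` is a leaf of
the $q$ members through `A`, and the $q$ spared edges from `c` to `A`, with the unused edges at `w`,
form one more member. -/
theorem cliqueMinus_empty_packs [DecidableEq V] (p : ℕ) (S : Finset V) (hS : S.card = 2 * p) :
    (cliqueMinus S ∅).Packs S p := by
  rcases p with _ | q
  · exact packs_zero _ _
  · obtain ⟨w, hw⟩ := Finset.card_pos.1 (show 0 < S.card by omega)
    have hQ : (S.erase w).card = 2 * q + 1 := by rw [Finset.card_erase_of_mem hw]; omega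
    have hwQ : w ∉ S.erase w := by simp
    have hSQ := Finset.insert_erase hw
    have hQS := Finset.erase_subset w S
    generalize S.erase w = Q at hQ hwQ hSQ hQS
    obtain ⟨c, hc⟩ := Finset.card_pos.1 (show 0 < Q.card by omega)
    obtain ⟨A, hA, hAc⟩ := Finset.exists_subset_card_eq (show q ≤ (Q.erase c).card by
      rw [Finset.card_erase_of_mem hc]; omega)
    have hAQ : A ⊆ Q := hA.trans (Finset.erase_subset _ _)
    have hcA : c ∉ A := fun h => Finset.ne_of_mem_erase (hA h) rfl
    have hwc : w ≠ c := fun h => hwQ (h ▸ hc)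
    have h := (cliqueMinus_star_packs q Q A c hQ hc hA hAc.le).attach (u := w)
      (fun x hx => hwQ hx.2.1) hAQ hwQ hAc.ge le_rfl
    rw [hSQ] at h
    refine h.succ (K := starOn w (Q \ A) ⊔ starOn c A) ?_ ?_ ?_
    · refine links_of_root w fun x hx => ?_
      rw [← hSQ, Finset.mem_insert] at hx
      rcases hx with rfl | hx
      · rfl
      have hcw : (starOn w (Q \ A) ⊔ starOn c A).Reachable c w :=
        Adj.reachable (Or.inl (starOn_adj.2 ⟨hwc.symm, Or.inr ⟨rfl, Finset.mem_sdiff.2 ⟨hc, hcA⟩⟩⟩))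
      by_cases hxA : x ∈ A
      · exact (Adj.reachable (Or.inr (starOn_adj_center hcA hxA).symm)).trans hcw
      · refine Adj.reachable (Or.inl (starOn_adj.2
          ⟨?_, Or.inr ⟨rfl, Finset.mem_sdiff.2 ⟨hx, hxA⟩⟩⟩))
        rintro rfl; exact hwQ hx
    · rw [disjoint_left]
      intro x y hx hy
      simp only [sup_adj, starOn_adj, cliqueMinus_adj, mem_starEdges, Finset.mem_sdiff] at hx hy
      grind
    · intro x y hx
      simp only [sup_adj, starOn_adj, cliqueMinus_adj, Finset.mem_sdiff] at hx ⊢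
      grind

/-! ### Packings for a $k$-set, using the vertices outside it -/

/-- All edges between `O` and `S`. -/
def joinOn (O S : Finset V) : SimpleGraph V :=
  fromRel fun x y => x ∈ O ∧ y ∈ S

theorem joinOn_adj {O S : Finset V} {x y : V} :
    (joinOn O S).Adj x y ↔ x ≠ y ∧ ((x ∈ O ∧ y ∈ S) ∨ (y ∈ O ∧ x ∈ S)) := by
  simp [joinOn]

theorem joinOn_packs {O S : Finset V} (h : Disjoint O S) : (joinOn O S).Packs S O.card := by
  refine packs_of_finset O (fun v => starOn v S) ?_ ?_ fun v _ => starOn_links v S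
  · intro v hv x y hxy
    rw [starOn_adj] at hxy
    rw [joinOn_adj]
    rcases hxy with ⟨h1, ⟨rfl, h2⟩ | ⟨rfl, h2⟩⟩
    · exact ⟨h1, Or.inl ⟨hv, h2⟩⟩
    · exact ⟨h1, Or.inr ⟨hv, h2⟩⟩
  · intro v hv w hw hvw
    have h' := Finset.disjoint_left.1 h
    rw [disjoint_left]
    intro x y hx hy
    rw [starOn_adj] at hx hy
    grind

/-- Each star centred in `O` lacks its edge to `c`; it reaches `c` through a private edge from `c`
to a vertex of `B`. -/
theorem joinOn_erase_packs [DecidableEq V] {O S B : Finset V} {c : V} (h : Disjoint O S)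
    (hc : c ∈ S) (hB : B ⊆ S.erase c) (hOB : O.card = B.card) :
    (joinOn O (S.erase c) ⊔ starOn c B).Packs S O.card := by
  let β : O ≃ B := Finset.equivOfCardEq hOB
  have hO := Finset.disjoint_left.1 h
  have hβ : ∀ v : O, (β v : V) ∈ S ∧ (β v : V) ≠ c := fun v =>
    (Finset.mem_erase.1 (hB (β v).2)).symm
  have := packs_of_finset (G := joinOn O (S.erase c) ⊔ starOn c B) (S := S) O.attach
    (fun v => starOn (v : V) (S.erase c) ⊔ edge c (β v)) ?_ ?_ ?_
  · rwa [Finset.card_attach] at this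
  · rintro ⟨v, hv⟩ -
    refine sup_le_sup ?_ ?_
    · intro x y hxy
      rw [starOn_adj] at hxy
      rw [joinOn_adj]
      rcases hxy with ⟨h1, ⟨rfl, h2⟩ | ⟨rfl, h2⟩⟩
      · exact ⟨h1, Or.inl ⟨hv, h2⟩⟩
      · exact ⟨h1, Or.inr ⟨hv, h2⟩⟩
    · intro x y hxy
      rw [edge_adj] at hxy
      rw [starOn_adj]
      rcases hxy with ⟨⟨rfl, rfl⟩ | ⟨rfl, rfl⟩, h⟩
      · exact ⟨h, Or.inl ⟨rfl, (β _).2⟩⟩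
      · exact ⟨h, Or.inr ⟨rfl, (β _).2⟩⟩
  · rintro v - w - hvw
    have h1 : (v : V) ≠ w := fun h => hvw (Subtype.ext h)
    have h2 : (β v : V) ≠ β w := fun h => hvw (β.injective (Subtype.ext h))
    have hv := hO v.2
    have hw := hO w.2
    have hv' := hβ v
    have hw' := hβ w
    rw [disjoint_left]
    intro x y hx hy
    simp only [sup_adj, starOn_adj, edge_adj, Finset.mem_erase] at hx hy
    grind
  · rintro v -
    have hv := hO v.2
    refine links_of_root (v : V) fun x hx => ?_
    have key : ∀ x ∈ S, x ≠ c →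
        (starOn (v : V) (S.erase c) ⊔ edge c (β v : V)).Reachable x v := fun x hx hxc =>
      Adj.reachable (Or.inl (starOn_adj.2 ⟨fun h => hv (h ▸ hx),
        Or.inr ⟨rfl, Finset.mem_erase.2 ⟨hxc, hx⟩⟩⟩))
    by_cases hxc : x = c
    · subst hxc
      exact (Adj.reachable (Or.inr (by simp [edge_adj, (hβ v).2.symm]))).trans
        (key _ (hβ v).1 (hβ v).2)
    · exact key x hx hxc

section
variable [Fintype V] [DecidableEq V]

/-- Removing at most $p$ edges at one vertex does not reduce the packing number of an odd set: the
clique on `S` has $p$ spare edges at any chosen vertex, and these repair the outside stars damaged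
by the removal. -/
theorem compl_star_packs {p : ℕ} {S A : Finset V} {c : V} (hS : S.card = 2 * p + 1)
    (hc : c ∉ A) (hA : A.card ≤ p) :
    (starOn c A)ᶜ.Packs S (p + (Fintype.card V - S.card)) := by
  have hSc := Finset.card_compl S
  have hAS := Finset.card_inter_add_card_sdiff A S
  have hG : ∀ x y, (starOn c A)ᶜ.Adj x y ↔
      x ≠ y ∧ ¬ ((x = c ∧ y ∈ A) ∨ (y = c ∧ x ∈ A)) := by
    intro x y
    rw [compl_adj, starOn_adj]
    tauto
  by_cases hcS : c ∈ S
  -- If `c` is in `S`, the damaged stars are those centred in `A \ S`. They borrow the edges from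
  -- `c` to `B`, so the clique must do without $|A\cap S|+|B|=|A|\le p$ edges at `c`.
  · obtain ⟨B, hB, hBc⟩ := Finset.exists_subset_card_eq
      (show (A \ S).card ≤ ((S.erase c) \ (A ∩ S)).card by
        have h1 := Finset.le_card_sdiff (A ∩ S) (S.erase c)
        rw [Finset.card_erase_of_mem hcS] at h1
        omega)
    have hB' : ∀ b ∈ B, b ≠ c ∧ b ∈ S ∧ b ∉ A := fun b hb => by
      have := hB hb
      simp only [Finset.mem_sdiff, Finset.mem_erase, Finset.mem_inter] at this
      tauto
    have h1 := cliqueMinus_star_packs p S (A ∩ S ∪ B) c hS hcS (fun a ha => by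
        rw [Finset.mem_erase]
        rcases Finset.mem_union.1 ha with ha | ha
        · rw [Finset.mem_inter] at ha
          exact ⟨fun h => hc (h ▸ ha.1), ha.2⟩
        · exact ⟨(hB' a ha).1, (hB' a ha).2.1⟩) ((Finset.card_union_le _ _).trans (by omega))
    have h2 := joinOn_erase_packs (O := A \ S) (S := S) (B := B) (c := c) Finset.sdiff_disjoint hcS
      (fun b hb => Finset.mem_erase.2 ⟨(hB' b hb).1, (hB' b hb).2.1⟩) hBc.symm
    have h3 := joinOn_packs (O := Sᶜ \ A) (S := S)
      (disjoint_compl_left.mono_left Finset.sdiff_subset)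
    have hcard : (Sᶜ \ A).card + (A \ S).card = Sᶜ.card := by
      rw [← Finset.card_union_of_disjoint]
      · congr 1
        ext a
        simp only [Finset.mem_union, Finset.mem_sdiff, Finset.mem_compl]
        tauto
      · rw [Finset.disjoint_left]
        intro a ha ha'
        exact (Finset.mem_sdiff.1 ha).2 (Finset.mem_sdiff.1 ha').1
    have h12 := h1.sup h2 ?_
    · refine (h12.sup h3 ?_).mono ?_ subset_rfl (by omega)
      · rw [disjoint_left]
        intro x y hx hy
        simp only [sup_adj, starOn_adj, joinOn_adj, cliqueMinus_adj, Finset.mem_sdiff,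
          Finset.mem_erase, Finset.mem_compl] at hx hy
        grind
      · intro x y hx
        rw [hG]
        simp only [sup_adj, starOn_adj, joinOn_adj, cliqueMinus_adj, mem_starEdges,
          Finset.mem_sdiff, Finset.mem_erase, Finset.mem_compl, Finset.mem_union,
          Finset.mem_inter] at hx
        grind
    · rw [disjoint_left]
      intro x y hx hy
      simp only [sup_adj, starOn_adj, joinOn_adj, cliqueMinus_adj, mem_starEdges,
          Finset.mem_sdiff, Finset.mem_erase, Finset.mem_union] at hx hy
      grind
  -- If `c` is outside `S`, only its own star is damaged; the vertices of `A ∩ S` are reached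
  -- through `r`, by edges spared in the clique.
  · obtain ⟨r, hr⟩ := Finset.card_pos.1 (show 0 < (S \ A).card by
      have := Finset.le_card_sdiff A S
      omega)
    obtain ⟨hrS, hrA⟩ := Finset.mem_sdiff.1 hr
    have h1 := cliqueMinus_star_packs p S (A ∩ S) r hS hrS (fun a ha => by
        rw [Finset.mem_inter] at ha
        exact Finset.mem_erase.2 ⟨fun h => hrA (h ▸ ha.1), ha.2⟩) (by omega)
    have h2 := joinOn_packs (O := Sᶜ.erase c) (S := S)
      (disjoint_compl_left.mono_left (Finset.erase_subset _ _))
    have hce := Finset.card_erase_of_mem (Finset.mem_compl.2 hcS)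
    have hpos := Finset.card_pos.2 ⟨c, Finset.mem_compl.2 hcS⟩
    have h12 := h1.sup h2 ?_
    · refine (h12.succ (K := starOn c (S \ A) ⊔ starOn r (A ∩ S)) (G' := (starOn c A)ᶜ)
        ?_ ?_ ?_).mono le_rfl subset_rfl (by omega)
      · refine links_of_root c fun x hx => ?_
        have key : ∀ x ∈ S, x ∉ A →
            (starOn c (S \ A) ⊔ starOn r (A ∩ S)).Reachable x c := fun x hx hxA =>
          Adj.reachable (Or.inl (starOn_adj.2 ⟨fun h => hcS (h ▸ hx),
            Or.inr ⟨rfl, Finset.mem_sdiff.2 ⟨hx, hxA⟩⟩⟩))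
        by_cases hxA : x ∈ A
        · exact (Adj.reachable (Or.inr (starOn_adj.2 ⟨by rintro rfl; exact hrA hxA,
            Or.inr ⟨rfl, Finset.mem_inter.2 ⟨hxA, hx⟩⟩⟩))).trans (key r hrS hrA)
        · exact key x hx hxA
      · rw [disjoint_left]
        intro x y hx hy
        simp only [sup_adj, starOn_adj, joinOn_adj, cliqueMinus_adj, mem_starEdges,
          Finset.mem_sdiff, Finset.mem_erase, Finset.mem_inter, Finset.mem_compl] at hx hy
        grind
      · intro x y hx
        rw [hG]
        simp only [sup_adj, starOn_adj, joinOn_adj, cliqueMinus_adj, mem_starEdges,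
          Finset.mem_sdiff, Finset.mem_erase, Finset.mem_inter, Finset.mem_compl] at hx
        grind
    · rw [disjoint_left]
      intro x y hx hy
      simp only [joinOn_adj, cliqueMinus_adj, Finset.mem_erase, Finset.mem_compl] at hx hy
      grind

theorem top_packs {S : Finset V} (hS : S.Nonempty) :
    (⊤ : SimpleGraph V).Packs S (S.card / 2 + (Fintype.card V - S.card)) := by
  rcases Nat.even_or_odd' S.card with ⟨p, hp | hp⟩
  · have h1 := cliqueMinus_empty_packs p S hp
    have h2 := joinOn_packs (O := Sᶜ) (S := S) disjoint_compl_left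
    have := Finset.card_compl S
    refine (h1.sup h2 ?_).mono le_top subset_rfl (by omega)
    rw [disjoint_left]
    intro x y hx hy
    simp only [joinOn_adj, cliqueMinus_adj, Finset.mem_compl] at hx hy
    grind
  · obtain ⟨c, -⟩ := hS
    exact (compl_star_packs (A := ∅) (c := c) hp (by simp) (by simp)).mono le_top subset_rfl
      (by omega)

end

/-! ### Upper bounds by degrees and by counting edges -/

theorem Reachable.exists_adj_of_ne {H : SimpleGraph V} {x y : V} (h : H.Reachable x y)
    (hne : x ≠ y) : ∃ z, H.Adj x z := by
  obtain ⟨w⟩ := h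
  cases w with
  | nil => exact (hne rfl).elim
  | cons h _ => exact ⟨_, h⟩

theorem Reachable.mem_of_closed {H : SimpleGraph V} {x y : V} (h : H.Reachable x y) {U : Set V}
    (hU : ∀ a b, H.Adj a b → a ∈ U → b ∈ U) (hx : x ∈ U) : y ∈ U := by
  obtain ⟨w⟩ := h
  induction w with
  | nil => exact hx
  | cons h _ ih => exact ih (hU _ _ h hx)

theorem Packs.le_degree {G : SimpleGraph V} {S : Finset V} {l : ℕ} (h : G.Packs S l) {u w : V}
    (hu : u ∈ S) (hw : w ∈ S) (huw : u ≠ w) [Fintype (G.neighborSet u)] : l ≤ G.degree u := by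
  obtain ⟨H, hG, hd, hl⟩ := h
  choose f hf using fun i => (hl i u hu w hw).exists_adj_of_ne huw
  have hinj : Function.Injective fun i => (⟨f i, hG i (hf i)⟩ : G.neighborSet u) := by
    intro i j hij
    by_contra hne
    have : f i = f j := congrArg Subtype.val hij
    exact disjoint_left.1 (hd i j hne) u (f i) (hf i) (this ▸ hf j)
  have := Fintype.card_le_of_injective _ hinj
  rwa [card_neighborSet_eq_degree, Fintype.card_fin] at this

/-- With $l\ge d$ members every edge at `u` and at `v` would be the only one of its member there.
The member containing `uv` would then have $\{u,v\}$ as a component and miss `w`. -/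
theorem Packs.lt_degree_of_adj {G : SimpleGraph V} {S : Finset V} {l d : ℕ} (h : G.Packs S l)
    {u v w : V} (hu : u ∈ S) (hv : v ∈ S) (hw : w ∈ S) (huw : u ≠ w) (hvw : v ≠ w)
    (huv : G.Adj u v) [Fintype (G.neighborSet u)] [Fintype (G.neighborSet v)]
    (hud : G.degree u ≤ d) (hvd : G.degree v ≤ d) : l < d := by
  by_contra hld
  obtain ⟨H, hG, hd, hl⟩ := h
  have tight : ∀ (u : V) [Fintype (G.neighborSet u)], u ∈ S → u ≠ w → G.degree u ≤ d →
      ∃ f : Fin l → V, (∀ z, G.Adj u z → ∃ i, f i = z) ∧ (∀ i, (H i).Adj u (f i)) ∧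
        ∀ i z, (H i).Adj u z → z = f i := by
    intro u _ hu huw hud
    choose f hf using fun i => (hl i u hu w hw).exists_adj_of_ne huw
    let g : Fin l → G.neighborSet u := fun i => ⟨f i, hG i (hf i)⟩
    have hinj : Function.Injective g := by
      intro i j hij
      by_contra hne
      have : f i = f j := congrArg Subtype.val hij
      exact disjoint_left.1 (hd i j hne) u (f i) (hf i) (this ▸ hf j)
    have hsurj : Function.Surjective g := by
      refine ((Fintype.bijective_iff_injective_and_card g).2 ⟨hinj, ?_⟩).2
      refine le_antisymm (Fintype.card_le_of_injective g hinj) ?_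
      rw [card_neighborSet_eq_degree, Fintype.card_fin]
      omega
    have hs : ∀ z, G.Adj u z → ∃ i, f i = z := fun z hz => by
      obtain ⟨i, hi⟩ := hsurj ⟨z, hz⟩
      exact ⟨i, congrArg Subtype.val hi⟩
    refine ⟨f, hs, hf, fun i z hz => ?_⟩
    obtain ⟨j, rfl⟩ := hs z (hG i hz)
    by_contra hne
    have hij : i ≠ j := fun h => hne (h ▸ rfl)
    exact disjoint_left.1 (hd i j hij) _ _ hz (hf j)
  obtain ⟨f, f1, f2, f3⟩ := tight u hu huw hud
  obtain ⟨g, g1, g2, g3⟩ := tight v hv hvw hvd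
  obtain ⟨i, hi⟩ := f1 v huv
  have hHi : (H i).Adj u v := hi ▸ f2 i
  have := (hl i u hu w hw).mem_of_closed (U := {u, v}) (fun a b hab ha => by
    rcases ha with rfl | rfl
    · right
      rw [f3 i b hab, hi]
      rfl
    · left
      rw [g3 i b hab, g3 i u hHi.symm]) (Or.inl rfl)
  rcases this with h | h
  · exact huw h.symm
  · exact hvw h.symm

theorem Reachable.exists_parent {H : SimpleGraph V} {s r : V} (h : H.Reachable s r) (hne : s ≠ r) :
    ∃ p, H.Adj s p ∧ H.dist p r < H.dist s r := by
  obtain ⟨w, hw⟩ := h.exists_walk_length_eq_dist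
  cases w with
  | nil => exact (hne rfl).elim
  | cons h w =>
    refine ⟨_, h, ?_⟩
    rw [← hw, Walk.length_cons]
    exact Nat.lt_succ_of_le (dist_le w)

open Classical in
/-- The edges of `G` with both ends in `S`. -/
noncomputable def edgesInside [Fintype V] (G : SimpleGraph V) (S : Finset V) : Finset (Sym2 V) :=
  Finset.univ.filter fun e => e ∈ G.edgeSet ∧ ∀ x ∈ e, x ∈ S

open Classical in
/-- The edges of `G` with at least one end in `S`. -/
noncomputable def edgesTouching [Fintype V] (G : SimpleGraph V) (S : Finset V) : Finset (Sym2 V) :=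
  Finset.univ.filter fun e => e ∈ G.edgeSet ∧ ∃ x ∈ e, x ∈ S

section
variable [Fintype V]

theorem mem_edgesInside {G : SimpleGraph V} {S : Finset V} {e : Sym2 V} :
    e ∈ G.edgesInside S ↔ e ∈ G.edgeSet ∧ ∀ x ∈ e, x ∈ S := by
  simp [edgesInside]

theorem mem_edgesTouching {G : SimpleGraph V} {S : Finset V} {e : Sym2 V} :
    e ∈ G.edgesTouching S ↔ e ∈ G.edgeSet ∧ ∃ x ∈ e, x ∈ S := by
  simp [edgesTouching]

theorem edgesInside_subset_edgesTouching (G : SimpleGraph V) (S : Finset V) :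
    G.edgesInside S ⊆ G.edgesTouching S := by
  intro e he
  rw [mem_edgesInside] at he
  rw [mem_edgesTouching]
  induction e with
  | h x y => exact ⟨he.1, x, Sym2.mem_mk_left _ _, he.2 x (Sym2.mem_mk_left _ _)⟩

/-- Send each vertex of `S` to the first edge of a shortest walk to a root; distances decrease, so
this is injective. If the component leaves `S`, a root outside `S` gives $|S|$ edges touching `S`.
Otherwise a root in `S` gives $|S|-1$ edges, all inside `S`. -/
theorem Links.card_le {H : SimpleGraph V} {S : Finset V} (hS : S.Nonempty) (h : H.Links S) :
    S.card ≤ (H.edgesInside S).card + 1 ∨ S.card ≤ (H.edgesTouching S).card := by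
  classical
  obtain ⟨s₀, hs₀⟩ := hS
  have parents : ∀ r, H.Reachable s₀ r → ∃ p : V → V, (∀ s ∈ S.erase r, H.Adj s (p s)) ∧
      Set.InjOn (fun s => s(s, p s)) (S.erase r : Finset V) := by
    intro r hr
    have := fun s (hs : s ∈ S.erase r) =>
      ((h s (Finset.mem_of_mem_erase hs) s₀ hs₀).trans hr).exists_parent (Finset.ne_of_mem_erase hs)
    choose! p hp using this
    refine ⟨p, fun s hs => (hp s hs).1, fun s hs t ht hst => ?_⟩
    rcases Sym2.eq_iff.1 hst with ⟨h1, -⟩ | ⟨h1, h2⟩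
    · exact h1
    · have h3 := (hp s hs).2
      have h4 := (hp t ht).2
      rw [h2] at h3
      rw [← h1] at h4
      omega
  by_cases hc : ∃ r, r ∉ S ∧ H.Reachable s₀ r
  · obtain ⟨r, hrS, hr⟩ := hc
    right
    obtain ⟨p, hp, hinj⟩ := parents r hr
    rw [Finset.erase_eq_of_notMem hrS] at hp hinj
    refine Finset.card_le_card_of_injOn _ (fun s hs => ?_) hinj
    exact mem_edgesTouching.2 ⟨hp s hs, s, Sym2.mem_mk_left _ _, hs⟩
  · push Not at hc
    left
    obtain ⟨p, hp, hinj⟩ := parents s₀ (Reachable.refl _)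
    have : (S.erase s₀).card ≤ (H.edgesInside S).card := by
      refine Finset.card_le_card_of_injOn _ (fun s hs => ?_) hinj
      refine mem_edgesInside.2 ⟨hp s hs, fun x hx => ?_⟩
      have hsS := Finset.mem_of_mem_erase (Finset.mem_coe.1 hs)
      rcases Sym2.mem_iff.1 hx with rfl | rfl
      · exact hsS
      · by_contra hn
        exact hc _ hn ((h s₀ hs₀ s hsS).trans (hp s hs).reachable)
    rw [Finset.card_erase_of_mem hs₀] at this
    omega

/-- Here `x` is the number of members with at least $|S|-1$ edges inside `S`; every other member has
at least $|S|$ edges touching `S`. -/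
theorem Packs.count {G : SimpleGraph V} {S : Finset V} {l : ℕ} (hS : S.Nonempty)
    (h : G.Packs S l) : ∃ x, x * (S.card - 1) ≤ (G.edgesInside S).card ∧
      l * S.card ≤ (G.edgesTouching S).card + x := by
  classical
  obtain ⟨H, hG, hd, hl⟩ := h
  have hdis : ∀ i j, i ≠ j → Disjoint (H i).edgeSet (H j).edgeSet := fun i j hij =>
    disjoint_edgeSet.2 (hd i j hij)
  let I := Finset.univ.filter fun i => S.card ≤ ((H i).edgesInside S).card + 1
  refine ⟨I.card, ?_, ?_⟩
  · calc I.card * (S.card - 1) ≤ ∑ i ∈ I, ((H i).edgesInside S).card := by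
          rw [← smul_eq_mul]
          refine Finset.card_nsmul_le_sum _ _ _ fun i hi => ?_
          have := (Finset.mem_filter.1 hi).2
          omega
      _ = (I.biUnion fun i => (H i).edgesInside S).card := by
          refine (Finset.card_biUnion fun i _ j _ hij => ?_).symm
          refine Finset.disjoint_left.2 fun e h1 h2 => ?_
          exact Set.disjoint_left.1 (hdis i j hij) (mem_edgesInside.1 h1).1 (mem_edgesInside.1 h2).1
      _ ≤ _ := by
          refine Finset.card_le_card fun e he => ?_
          obtain ⟨i, -, hi⟩ := Finset.mem_biUnion.1 he
          rw [mem_edgesInside] at hi ⊢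
          exact ⟨edgeSet_mono (hG i) hi.1, hi.2⟩
  · have h1 : ∑ i, ((H i).edgesTouching S).card ≤ (G.edgesTouching S).card := by
      rw [← Finset.card_biUnion]
      · refine Finset.card_le_card fun e he => ?_
        obtain ⟨i, -, hi⟩ := Finset.mem_biUnion.1 he
        rw [mem_edgesTouching] at hi ⊢
        exact ⟨edgeSet_mono (hG i) hi.1, hi.2⟩
      · refine fun i _ j _ hij => Finset.disjoint_left.2 fun e h1 h2 => ?_
        exact Set.disjoint_left.1 (hdis i j hij) (mem_edgesTouching.1 h1).1
          (mem_edgesTouching.1 h2).1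
    have h2 : ∑ i : Fin l, S.card ≤
        ∑ i, (((H i).edgesTouching S).card + if i ∈ I then 1 else 0) := by
      refine Finset.sum_le_sum fun i _ => ?_
      split_ifs with hi
      · have h3 := (Finset.mem_filter.1 hi).2
        have h4 := Finset.card_le_card ((H i).edgesInside_subset_edgesTouching S)
        omega
      · have h3 : ¬ S.card ≤ ((H i).edgesInside S).card + 1 := fun h =>
          hi (Finset.mem_filter.2 ⟨Finset.mem_univ _, h⟩)
        rcases (hl i).card_le hS with h4 | h4 <;> omega
    rw [Finset.sum_add_distrib, Finset.sum_ite_mem, Finset.univ_inter] at h2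
    simp only [Finset.sum_const, Finset.card_univ, Fintype.card_fin, smul_eq_mul, mul_one] at h2
    omega

theorem card_edgesInside_top (S : Finset V) :
    ((⊤ : SimpleGraph V).edgesInside S).card = S.card.choose 2 := by
  classical
  rw [← Sym2.card_image_offDiag]
  congr 1
  ext e
  induction e with
  | h x y =>
    rw [mem_edgesInside, Finset.mem_image]
    constructor
    · rintro ⟨h1, h2⟩
      exact ⟨(x, y), Finset.mem_offDiag.2 ⟨h2 x (by simp), h2 y (by simp), by simpa using h1⟩, rfl⟩
    · rintro ⟨⟨a, b⟩, h, h'⟩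
      rw [Finset.mem_offDiag] at h
      rw [← h']
      refine ⟨by simpa using h.2.2, fun z hz => ?_⟩
      rcases Sym2.mem_iff.1 hz with rfl | rfl
      · exact h.1
      · exact h.2.1

theorem card_edgesTouching_top_le (S : Finset V) :
    ((⊤ : SimpleGraph V).edgesTouching S).card ≤
      S.card.choose 2 + S.card * (Fintype.card V - S.card) := by
  classical
  rw [← card_edgesInside_top, ← Finset.card_compl, ← Finset.card_product]
  refine le_trans (Finset.card_le_card (t := (⊤ : SimpleGraph V).edgesInside S ∪
    (S ×ˢ Sᶜ).image fun q => s(q.1, q.2)) fun e he => ?_)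
    ((Finset.card_union_le _ _).trans (Nat.add_le_add_left Finset.card_image_le _))
  induction e with
  | h x y =>
    obtain ⟨h1, z, hz, hzS⟩ := mem_edgesTouching.1 he
    rw [Finset.mem_union, mem_edgesInside, Finset.mem_image]
    by_cases hx : x ∈ S <;> by_cases hy : y ∈ S
    · left
      refine ⟨h1, fun w hw => ?_⟩
      rcases Sym2.mem_iff.1 hw with rfl | rfl <;> assumption
    · exact Or.inr ⟨(x, y), by simp [hx, hy], rfl⟩
    · exact Or.inr ⟨(y, x), by simp [hx, hy], Sym2.eq_swap⟩
    · rcases Sym2.mem_iff.1 hz with rfl | rfl <;> contradiction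

theorem card_edgesInside_add_compl (G : SimpleGraph V) (S : Finset V) :
    (G.edgesInside S).card + (Gᶜ.edgesInside S).card = S.card.choose 2 := by
  classical
  rw [← card_edgesInside_top, ← Finset.card_union_of_disjoint]
  · congr 1
    ext e
    induction e with
    | h x y =>
      simp only [Finset.mem_union, mem_edgesInside, mem_edgeSet, compl_adj, top_adj]
      have : G.Adj x y → x ≠ y := fun h => h.ne
      tauto
  · rw [Finset.disjoint_left]
    intro e h1 h2
    exact Set.disjoint_left.1 (disjoint_edgeSet.2 disjoint_compl_right) (mem_edgesInside.1 h1).1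
      (mem_edgesInside.1 h2).1

theorem card_edgesTouching_add_compl_le (G : SimpleGraph V) (S : Finset V) :
    (G.edgesTouching S).card + (Gᶜ.edgesTouching S).card ≤
      S.card.choose 2 + S.card * (Fintype.card V - S.card) := by
  classical
  refine le_trans ?_ (card_edgesTouching_top_le S)
  rw [← Finset.card_union_of_disjoint]
  · refine Finset.card_le_card fun e he => ?_
    rw [mem_edgesTouching]
    rcases Finset.mem_union.1 he with he | he <;> rw [mem_edgesTouching] at he
    · exact ⟨edgeSet_mono le_top he.1, he.2⟩
    · exact ⟨edgeSet_mono le_top he.1, he.2⟩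
  · rw [Finset.disjoint_left]
    intro e h1 h2
    exact Set.disjoint_left.1 (disjoint_edgeSet.2 disjoint_compl_right) (mem_edgesTouching.1 h1).1
      (mem_edgesTouching.1 h2).1

theorem Packs.compl_count {G : SimpleGraph V} {S : Finset V} {l : ℕ} (hS : S.Nonempty)
    (h : Gᶜ.Packs S l) : ∃ x, x * (S.card - 1) + (G.edgesInside S).card ≤ S.card.choose 2 ∧
      l * S.card + (G.edgesTouching S).card ≤
        S.card.choose 2 + S.card * (Fintype.card V - S.card) + x := by
  obtain ⟨x, h1, h2⟩ := h.count hS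
  have h3 := card_edgesInside_add_compl G S
  have h4 := card_edgesTouching_add_compl_le G S
  exact ⟨x, by omega, by omega⟩

/-- The inside count gives $2p\,x\le p(2p+1)$, so $x\le p<|S|$. The touching count therefore has
slack $p$, used up once more than $p$ edges of `G` touch `S`. -/
theorem Packs.compl_bound_odd {G : SimpleGraph V} {S : Finset V} {l p : ℕ} (hp : 0 < p)
    (hS : S.card = 2 * p + 1) (h : Gᶜ.Packs S l) :
    l ≤ p + (Fintype.card V - S.card) ∧
      (p < (G.edgesTouching S).card → l < p + (Fintype.card V - S.card)) := by
  obtain ⟨x, h1, h2⟩ := h.compl_count (Finset.card_pos.1 (by omega))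
  generalize Fintype.card V - S.card = D at h2 ⊢
  have hc : (2 * p + 1).choose 2 = (2 * p + 1) * p := by
    rw [Nat.choose_two_right, Nat.add_sub_cancel, mul_left_comm, Nat.mul_div_cancel_left _ two_pos]
  rw [hS, hc] at h1 h2
  rw [Nat.add_sub_cancel] at h1
  have hx : x ≤ p := by
    by_contra hx
    have : (p + 1) * (2 * p) ≤ x * (2 * p) := Nat.mul_le_mul_right _ (by omega)
    nlinarith
  have e1 : (p + D + 1) * (2 * p + 1) = (2 * p + 1) * p + (2 * p + 1) * D + (2 * p + 1) := by ring
  have e2 : (p + D) * (2 * p + 1) = (2 * p + 1) * p + (2 * p + 1) * D := by ring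
  refine ⟨?_, fun hG => ?_⟩
  · have : l * (2 * p + 1) < (p + D + 1) * (2 * p + 1) := by omega
    exact Nat.lt_succ_iff.1 (Nat.lt_of_mul_lt_mul_right this)
  · have : l * (2 * p + 1) < (p + D) * (2 * p + 1) := by omega
    exact Nat.lt_of_mul_lt_mul_right this

/-- Both counts are exact here: $x\le p$, with strict inequality as soon as one edge of `G` lies
inside `S`. -/
theorem Packs.compl_bound_even {G : SimpleGraph V} {S : Finset V} {l p : ℕ} (hp : 0 < p)
    (hS : S.card = 2 * p) (h : Gᶜ.Packs S l) :
    l ≤ p + (Fintype.card V - S.card) ∧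
      (0 < (G.edgesInside S).card → l < p + (Fintype.card V - S.card)) := by
  obtain ⟨x, h1, h2⟩ := h.compl_count (Finset.card_pos.1 (by omega))
  generalize Fintype.card V - S.card = D at h2 ⊢
  have hc : (2 * p).choose 2 = p * (2 * p - 1) := by
    rw [Nat.choose_two_right, mul_assoc, Nat.mul_div_cancel_left _ two_pos]
  rw [hS, hc] at h1 h2
  have e0 : p * (2 * p - 1) + p = p * (2 * p) := by
    obtain ⟨q, rfl⟩ := Nat.exists_eq_add_of_lt hp
    simp only [zero_add, show 2 * (q + 1) - 1 = 2 * q + 1 by omega]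
    ring
  have e1 : (p + D) * (2 * p) = p * (2 * p) + 2 * p * D := by ring
  have hx : x ≤ p := Nat.le_of_mul_le_mul_right (show x * (2 * p - 1) ≤ p * (2 * p - 1) by omega)
    (by omega)
  refine ⟨?_, fun hG => ?_⟩
  · exact Nat.le_of_mul_le_mul_right (show l * (2 * p) ≤ (p + D) * (2 * p) by omega) (by omega)
  · have hx : x < p :=
      Nat.lt_of_mul_lt_mul_right (show x * (2 * p - 1) < p * (2 * p - 1) by omega)
    exact Nat.lt_of_mul_lt_mul_right (show l * (2 * p) < (p + D) * (2 * p) by omega)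

/-! ### From packings to $\lambda_k$ -/

theorem packs_localEdgeConn (G : SimpleGraph V) {S : Finset V} (hS : 2 ≤ S.card) :
    G.Packs S (localEdgeConn G S) := by
  classical
  obtain ⟨u, hu, w, hw, huw⟩ := Finset.one_lt_card.1 hS
  rw [← hasSteinerPacking_iff_packs ⟨u, hu⟩]
  refine Nat.sSup_mem (s := {l | HasSteinerPacking G S l})
    ⟨0, (hasSteinerPacking_iff_packs ⟨u, hu⟩).2 (packs_zero _ _)⟩ ⟨G.degree u, fun l hl => ?_⟩
  exact ((hasSteinerPacking_iff_packs ⟨u, hu⟩).1 hl).le_degree hu hw huw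

theorem Packs.le_localEdgeConn {G : SimpleGraph V} {S : Finset V} {l : ℕ} (hS : 2 ≤ S.card)
    (h : G.Packs S l) : l ≤ localEdgeConn G S := by
  classical
  obtain ⟨u, hu, w, hw, huw⟩ := Finset.one_lt_card.1 hS
  refine le_csSup (s := {l | HasSteinerPacking G S l}) ⟨G.degree u, fun l hl => ?_⟩
    ((hasSteinerPacking_iff_packs ⟨u, hu⟩).2 h)
  exact ((hasSteinerPacking_iff_packs ⟨u, hu⟩).1 hl).le_degree hu hw huw

theorem packs_genEdgeConn (G : SimpleGraph V) {S : Finset V} (hS : 2 ≤ S.card) :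
    G.Packs S (genEdgeConn G S.card) :=
  (packs_localEdgeConn G hS).mono le_rfl subset_rfl (Nat.sInf_le ⟨S, rfl, rfl⟩)

theorem le_genEdgeConn {G : SimpleGraph V} {k l : ℕ} (hk : 2 ≤ k) (hkV : k ≤ Fintype.card V)
    (h : ∀ S : Finset V, S.card = k → G.Packs S l) : l ≤ genEdgeConn G k := by
  obtain ⟨S, hS⟩ := Finset.exists_subset_card_eq (s := (Finset.univ : Finset V))
    (by simpa using hkV)
  refine le_csInf ⟨_, S, hS.2, rfl⟩ ?_
  rintro _ ⟨S, rfl, rfl⟩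
  exact (h S rfl).le_localEdgeConn hk

theorem le_genEdgeConn_of_packs_univ {G : SimpleGraph V} {k l : ℕ} (hk : 2 ≤ k)
    (hkV : k ≤ Fintype.card V) (h : G.Packs Finset.univ l) : l ≤ genEdgeConn G k :=
  le_genEdgeConn hk hkV fun _ _ => h.mono le_rfl (Finset.subset_univ _) le_rfl

theorem one_le_genEdgeConn {G : SimpleGraph V} {k : ℕ} (hk : 2 ≤ k)
    (hkV : k ≤ Fintype.card V) (h : G.Connected) : 1 ≤ genEdgeConn G k :=
  le_genEdgeConn_of_packs_univ hk hkV (packs_one fun x _ y _ => h.preconnected x y)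

theorem genEdgeConn_mono {G G' : SimpleGraph V} {k : ℕ} (hk : 2 ≤ k)
    (hkV : k ≤ Fintype.card V) (h : G ≤ G') : genEdgeConn G k ≤ genEdgeConn G' k :=
  le_genEdgeConn hk hkV fun _ hS =>
    (hS ▸ packs_genEdgeConn G (hS.symm ▸ hk)).mono h subset_rfl le_rfl

theorem genEdgeConn_le_degree [DecidableEq V] {G : SimpleGraph V} [DecidableRel G.Adj] {k : ℕ}
    (hk : 2 ≤ k) (hkV : k ≤ Fintype.card V) (u : V) : genEdgeConn G k ≤ G.degree u := by
  obtain ⟨S, hu, -, rfl⟩ := Finset.exists_subsuperset_card_eq (Finset.subset_univ {u})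
    (show ({u} : Finset V).card ≤ k by simp; omega) (by simpa using hkV)
  rw [Finset.singleton_subset_iff] at hu
  obtain ⟨w, hw, hwu⟩ := Finset.exists_mem_ne hk u
  exact (packs_genEdgeConn G hk).le_degree hu hw hwu.symm

theorem genEdgeConn_lt_of_adj [DecidableEq V] {G : SimpleGraph V} [DecidableRel G.Adj] {k d : ℕ}
    (hk : 3 ≤ k) (hkV : k ≤ Fintype.card V) {u v : V} (huv : G.Adj u v) (hu : G.degree u ≤ d)
    (hv : G.degree v ≤ d) : genEdgeConn G k < d := by
  obtain ⟨S, hS, -, rfl⟩ := Finset.exists_subsuperset_card_eq (Finset.subset_univ {u, v})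
    (show ({u, v} : Finset V).card ≤ k from Finset.card_le_two.trans (by omega))
    (by simpa using hkV)
  rw [Finset.insert_subset_iff, Finset.singleton_subset_iff] at hS
  obtain ⟨w, hw⟩ := Finset.card_pos.1 (show 0 < (S \ {u, v}).card by
    have := Finset.le_card_sdiff {u, v} S
    have := Finset.card_le_two (a := u) (b := v)
    omega)
  simp only [Finset.mem_sdiff, Finset.mem_insert, Finset.mem_singleton, not_or] at hw
  exact (packs_genEdgeConn G (by omega)).lt_degree_of_adj hS.1 hS.2 hw.1 (Ne.symm hw.2.1)
    (Ne.symm hw.2.2) huv hu hv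

theorem genEdgeConn_top_ge {k : ℕ} (hk : 2 ≤ k) (hkV : k ≤ Fintype.card V) :
    k / 2 + (Fintype.card V - k) ≤ genEdgeConn (⊤ : SimpleGraph V) k := by
  classical
  refine le_genEdgeConn hk hkV fun S hS => ?_
  subst hS
  exact top_packs (Finset.card_pos.1 (by omega))

theorem genEdgeConn_add_compl_packs (G : SimpleGraph V) {S : Finset V} (hS : 2 ≤ S.card) :
    (⊤ : SimpleGraph V).Packs S (genEdgeConn G S.card + genEdgeConn Gᶜ S.card) :=
  ((packs_genEdgeConn G hS).sup (packs_genEdgeConn Gᶜ hS) disjoint_compl_right).mono le_top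
    subset_rfl le_rfl

theorem genEdgeConn_add_compl_le (G : SimpleGraph V) {k : ℕ} (hk : 2 ≤ k)
    (hkV : k ≤ Fintype.card V) :
    genEdgeConn G k + genEdgeConn Gᶜ k ≤ k / 2 + (Fintype.card V - k) := by
  obtain ⟨S, -, rfl⟩ := Finset.exists_subset_card_eq (s := (Finset.univ : Finset V))
    (by simpa using hkV)
  have h := genEdgeConn_add_compl_packs G hk
  rw [← compl_bot] at h
  rcases Nat.even_or_odd' S.card with ⟨p, hp | hp⟩
  · have := (h.compl_bound_even (by omega) hp).1
    omega
  · have := (h.compl_bound_odd (by omega) hp).1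
    omega

theorem genEdgeConn_compl_lt_of_even {G : SimpleGraph V} {k : ℕ} (hk : 2 ≤ k)
    (hkV : k ≤ Fintype.card V) (he : Even k) {u v : V} (huv : G.Adj u v) :
    genEdgeConn Gᶜ k < k / 2 + (Fintype.card V - k) := by
  classical
  obtain ⟨S, hS, -, rfl⟩ := Finset.exists_subsuperset_card_eq (Finset.subset_univ {u, v})
    (show ({u, v} : Finset V).card ≤ k from Finset.card_le_two.trans hk) (by simpa using hkV)
  rw [Finset.insert_subset_iff, Finset.singleton_subset_iff] at hS
  obtain ⟨p, hp⟩ := he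
  have := ((packs_genEdgeConn Gᶜ hk).compl_bound_even (p := p) (by omega) (by omega)).2
    (Finset.card_pos.2 ⟨s(u, v), mem_edgesInside.2 ⟨huv, fun x hx => by
      rcases Sym2.mem_iff.1 hx with rfl | rfl
      · exact hS.1
      · exact hS.2⟩⟩)
  omega

/-- Choose `S` to contain one end of each of $(k+1)/2=p+1$ edges of `G`. -/
theorem genEdgeConn_compl_lt_of_odd {G : SimpleGraph V} {k : ℕ} (hk : 2 ≤ k)
    (hkV : k ≤ Fintype.card V) (ho : Odd k) (hG : (k + 1) / 2 ≤ G.edgeSet.ncard) :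
    genEdgeConn Gᶜ k < k / 2 + (Fintype.card V - k) := by
  classical
  rw [← coe_edgeFinset, Set.ncard_coe_finset] at hG
  obtain ⟨F, hF, hFc⟩ := Finset.exists_subset_card_eq hG
  obtain ⟨S, hS, -, rfl⟩ := Finset.exists_subsuperset_card_eq (n := k)
    (Finset.subset_univ (F.image fun e => e.out.1))
    ((Finset.card_image_le (s := F)).trans (by omega))
    (by simpa using hkV)
  obtain ⟨p, hp⟩ := ho
  have hFS : F.card ≤ (G.edgesTouching S).card := Finset.card_le_card fun e he =>
    mem_edgesTouching.2 ⟨mem_edgeFinset.1 (hF he), e.out.1, Sym2.out_fst_mem e,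
      hS (Finset.mem_image_of_mem _ he)⟩
  have := ((packs_genEdgeConn Gᶜ hk).compl_bound_odd (p := p) (by omega) hp).2 (by omega)
  omega

theorem not_connected_of_ncard {G : SimpleGraph V} (h : G.edgeSet.ncard < Fintype.card V - 1) :
    ¬ G.Connected := by
  intro hc
  have := hc.card_vert_le_card_edgeSet_add_one
  rw [Nat.card_eq_fintype_card, Nat.card_coe_set_eq] at this
  omega

/-- The last hypothesis is the condition $2m\le l+2t$ of `cliqueMinus_packs` with $t=n-2l-1$. -/
theorem le_genEdgeConn_compl {G : SimpleGraph V} {k l : ℕ} (hk : 2 ≤ k)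
    (hkV : k ≤ Fintype.card V) (h1 : 2 * l + 1 ≤ Fintype.card V)
    (h2 : 2 * G.edgeSet.ncard + 3 * l + 2 ≤ 2 * Fintype.card V) : l ≤ genEdgeConn Gᶜ k := by
  classical
  rw [← coe_edgeFinset, Set.ncard_coe_finset] at h2
  refine le_genEdgeConn_of_packs_univ hk hkV ((cliqueMinus_packs l (Fintype.card V - (2 * l + 1))
    Finset.univ G.edgeFinset (by rw [Finset.card_univ]; omega) (by omega)).mono ?_ subset_rfl le_rfl)
  rintro x y ⟨h1, -, -, h3⟩
  rw [compl_adj]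
  exact ⟨h1, fun h => h3 (by simpa using h)⟩

/-! ### The bounds $L$, $M$ and $N$ -/

theorem ceil_half (k : ℕ) : ⌈(k : ℚ) / 2⌉ = ((k + 1) / 2 : ℕ) := by
  rw [Int.ceil_eq_iff]
  rcases Nat.even_or_odd' k with ⟨p, rfl | rfl⟩
  · rw [show (2 * p + 1) / 2 = p by omega]
    push_cast
    constructor <;> linarith
  · rw [show (2 * p + 1 + 1) / 2 = p + 1 by omega]
    push_cast
    constructor <;> linarith

theorem boundM_of_first {k n m : ℕ} (h : FirstCaseM k n m) (hkn : k ≤ n) :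
    boundM k n m = (k / 2 + (n - k) : ℕ) := by
  rw [boundM, if_pos h, ceil_half]
  omega

theorem boundM_of_not_first {k n m : ℕ} (h : ¬ FirstCaseM k n m) (hkn : k ≤ n) :
    boundM k n m = (k / 2 + (n - k) : ℕ) - 1 := by
  rw [boundM, if_neg h, ceil_half]
  omega

theorem connSum_le_boundM {G : SimpleGraph V} {k m : ℕ} (hk : 3 ≤ k)
    (hkV : k ≤ Fintype.card V) (hm : G.edgeSet.ncard = m) :
    connSum G k ≤ boundM k (Fintype.card V) m := by
  by_cases hf : FirstCaseM k (Fintype.card V) m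
  · rw [boundM_of_first hf hkV, connSum]
    exact_mod_cast genEdgeConn_add_compl_le G (by omega) hkV
  · rw [boundM_of_not_first hf hkV, connSum]
    simp only [FirstCaseM, not_or, not_le, not_and] at hf
    obtain ⟨h1, h2, h3⟩ := hf
    rw [genEdgeConn_of_not_connected G k (by omega) hkV (not_connected_of_ncard (by omega))]
    have : genEdgeConn Gᶜ k < k / 2 + (Fintype.card V - k) := by
      rcases Nat.even_or_odd k with he | ho
      · obtain ⟨e, he'⟩ := Set.nonempty_of_ncard_ne_zero (s := G.edgeSet) (by have := h2 he; omega)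
        induction e with
        | h u v => exact genEdgeConn_compl_lt_of_even (by omega) hkV he he'
      · exact genEdgeConn_compl_lt_of_odd (by omega) hkV ho (by have := h3 ho; omega)
    omega

theorem boundL_le_connSum {G : SimpleGraph V} {k m : ℕ} (hV : 6 ≤ Fintype.card V) (hk : 3 ≤ k)
    (hkV : k ≤ Fintype.card V) (hm : G.edgeSet.ncard = m) :
    boundL (Fintype.card V) m ≤ connSum G k := by
  classical
  have hne : Nonempty V := Fintype.card_pos_iff.1 (by omega)
  have hlow : ∀ L : ℤ, 2 * L + 1 ≤ Fintype.card V → 2 * m + 3 * L + 2 ≤ 2 * Fintype.card V →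
      L ≤ connSum G k := by
    intro L h1 h2
    rcases le_or_gt L 0 with h | h
    · exact h.trans (by unfold connSum; positivity)
    · lift L to ℕ using h.le
      have := le_genEdgeConn_compl (G := G) (k := k) (l := L) (by omega) hkV (by omega) (by omega)
      unfold connSum
      omega
  generalize hn : Fintype.card V = n at *
  rw [boundL]
  split_ifs with h
  -- For $m=0$ the bound is $\lfloor n/2\rfloor$, which violates $2L+1\le n$ when $n$ is even; the
  -- complete graph is used directly.
  · rcases Nat.eq_zero_or_pos m with rfl | hm0
    · have hG : G = ⊥ := by
        rw [← edgeSet_eq_empty]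
        exact (Set.ncard_eq_zero).1 hm
      have h1 := genEdgeConn_top_ge (V := V) (k := k) (by omega) (by omega)
      rw [hn] at h1
      refine (min_le_right _ _).trans ?_
      rw [connSum, hG, compl_bot]
      have : ⌊(n : ℚ) / 2 - 2 * ((0 : ℕ) : ℚ) / ((n : ℚ) - 1)⌋ ≤ ((k / 2 + (n - k) : ℕ) : ℤ) := by
        rw [Int.floor_le_iff]
        have h2 : n < 2 * (k / 2 + (n - k) + 1) := by omega
        have h3 : (n : ℚ) < 2 * (((k / 2 + (n - k) : ℕ) : ℚ) + 1) := by exact_mod_cast h2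
        simp only [Nat.cast_zero, mul_zero, zero_div, sub_zero, Int.cast_natCast]
        linarith
      omega
    · have hL1 := min_le_left ((n : ℤ) - 2 * m - 1) ⌊(n : ℚ) / 2 - 2 * (m : ℚ) / ((n : ℚ) - 1)⌋
      have hL2 := min_le_right ((n : ℤ) - 2 * m - 1) ⌊(n : ℚ) / 2 - 2 * (m : ℚ) / ((n : ℚ) - 1)⌋
      generalize min ((n : ℤ) - 2 * m - 1) ⌊(n : ℚ) / 2 - 2 * (m : ℚ) / ((n : ℚ) - 1)⌋ = L
        at hL1 hL2
      rw [Int.le_floor] at hL2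
      have h4 : 2 * L < n := by
        have : (0 : ℚ) < 2 * (m : ℚ) / ((n : ℚ) - 1) := by
          have : (1 : ℚ) < n := by exact_mod_cast (by omega : 1 < n)
          have : (0 : ℚ) < m := by exact_mod_cast hm0
          apply div_pos <;> linarith
        have : (2 * L : ℚ) < n := by linarith
        exact_mod_cast this
      exact hlow L (by omega) (by omega)
  · refine max_le ?_ ?_
    · unfold connSum
      rcases G.connected_or_connected_compl with hc | hc
      · have := one_le_genEdgeConn (k := k) (by omega) (by omega) hc
        omega
      · have := one_le_genEdgeConn (k := k) (by omega) (by omega) hc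
        omega
    · have hL := Int.floor_le (((n : ℚ) - 2 - m) / 2)
      generalize ⌊((n : ℚ) - 2 - m) / 2⌋ = L at hL
      have h4 : 2 * L ≤ n - 2 - m := by
        have : (2 * L : ℚ) ≤ n - 2 - m := by linarith
        exact_mod_cast this
      rcases le_or_gt L 0 with h0 | h0
      · exact h0.trans (by unfold connSum; positivity)
      · exact hlow L (by omega) (by omega)

theorem floor_two_mul_div (m n : ℕ) : ⌊2 * (m : ℚ) / n⌋ = ((2 * m / n : ℕ) : ℤ) := by
  have := Rat.floor_natCast_div_natCast (2 * m) n
  push_cast at this ⊢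
  exact this

theorem connProd_le_boundN {G : SimpleGraph V} {k m : ℕ} (hV : 2 ≤ Fintype.card V) (hk : 3 ≤ k)
    (hkV : k ≤ Fintype.card V) (hm : G.edgeSet.ncard = m) (hm' : m < (Fintype.card V).choose 2) :
    connProd G k ≤ boundN (Fintype.card V) m := by
  classical
  have hne : Nonempty V := Fintype.card_pos_iff.1 (by omega)
  rw [boundN, connProd]
  split_ifs with h1 h2
  · rw [genEdgeConn_of_not_connected G k (by omega) hkV (not_connected_of_ncard (by omega))]
    simp
  all_goals
    have hsum : ∑ v, G.degree v = 2 * m := by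
      rw [sum_degrees_eq_twice_card_edges, ← hm, ← coe_edgeFinset, Set.ncard_coe_finset]
    have ha : ∀ u, genEdgeConn G k ≤ G.degree u := genEdgeConn_le_degree (by omega) hkV
    have hb : ∀ u, genEdgeConn Gᶜ k ≤ Fintype.card V - 1 - G.degree u := fun u => by
      rw [← degree_compl]
      exact genEdgeConn_le_degree (by omega) hkV u
    have hdeg : ∀ u, G.degree u < Fintype.card V := fun u => G.degree_lt_card_verts u
    have fin : ∀ a' b' : ℤ, (genEdgeConn G k : ℤ) ≤ a' → (genEdgeConn Gᶜ k : ℤ) ≤ b' →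
        (genEdgeConn G k : ℤ) * (genEdgeConn Gᶜ k : ℤ) ≤ a' * b' := fun a' b' h h' =>
      mul_le_mul h h' (by positivity) (le_trans (by positivity) h)
    have hmn : 2 * m < Fintype.card V * (Fintype.card V - 1) := by
      rw [Nat.choose_two_right] at hm'
      have := Nat.div_mul_le_self (Fintype.card V * (Fintype.card V - 1)) 2
      omega
  · obtain ⟨d, hd⟩ := h2
    have hd' : 2 * m / Fintype.card V = d := by rw [hd, Nat.mul_div_cancel_left _ (by omega)]
    rw [hd']
    have hd1 : 1 ≤ d := by
      by_contra hd0
      have : d = 0 := by omega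
      subst this
      omega
    have hdn : d < Fintype.card V - 1 := Nat.lt_of_mul_lt_mul_left (hd ▸ hmn)
    -- Regular graphs and their complements have adjacent vertices of minimum degree, losing one in
    -- each factor. A non-regular graph of average degree $d$ has degrees on both sides of $d$, with
    -- the same effect.
    by_cases hreg : ∀ u, G.degree u = d
    · obtain ⟨u⟩ := hne
      obtain ⟨v, hv⟩ := (G.degree_pos_iff_exists_adj u).1 (by rw [hreg]; omega)
      have hcd : ∀ u, Gᶜ.degree u = Fintype.card V - 1 - d := fun u => by
        rw [degree_compl, hreg]
      obtain ⟨w, hw⟩ := (Gᶜ.degree_pos_iff_exists_adj u).1 (by rw [hcd]; omega)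
      have h3 := genEdgeConn_lt_of_adj hk hkV hv (hreg u).le (hreg v).le
      have h4 := genEdgeConn_lt_of_adj hk hkV hw (hcd u).le (hcd w).le
      exact fin _ _ (by omega) (by omega)
    · have hsum' : ∑ v, G.degree v = ∑ _v : V, d := by
        rw [hsum, hd, Finset.sum_const, Finset.card_univ, smul_eq_mul]
      push Not at hreg
      obtain ⟨w, hw⟩ := hreg
      obtain ⟨u, hu⟩ : ∃ u, G.degree u < d := by
        by_contra hc
        push Not at hc
        exact hw ((Finset.sum_eq_sum_iff_of_le (fun i _ => hc i)).1 hsum'.symm w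
          (Finset.mem_univ _)).symm
      obtain ⟨v, hv⟩ : ∃ v, d < G.degree v := by
        by_contra hc
        push Not at hc
        exact hw ((Finset.sum_eq_sum_iff_of_le (fun i _ => hc i)).1 hsum' w (Finset.mem_univ _))
      have h3 := ha u
      have h4 := hb v
      have h5 := hdeg v
      exact fin _ _ (by omega) (by omega)
  · rw [floor_two_mul_div]
    -- As $n\nmid 2m$, the average degree lies strictly between $d$ and $d+1$, so some degree is at
    -- most $d$ and some degree at least $d+1$.
    have hlt := Nat.lt_div_mul_add (a := 2 * m) (b := Fintype.card V) (by omega)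
    have hle : 2 * m / Fintype.card V * Fintype.card V < 2 * m :=
      lt_of_le_of_ne (Nat.div_mul_le_self _ _) fun h => h2 (Dvd.intro_left _ h)
    generalize 2 * m / Fintype.card V = d at hlt hle
    obtain ⟨u, -, hu⟩ := Finset.exists_lt_of_sum_lt (s := Finset.univ) (f := fun v => G.degree v)
      (g := fun _ : V => d + 1) (by
        rw [hsum, Finset.sum_const, Finset.card_univ, smul_eq_mul, mul_add, mul_comm _ d]; omega)
    obtain ⟨v, -, hv⟩ := Finset.exists_lt_of_sum_lt (s := Finset.univ) (g := fun v => G.degree v)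
      (f := fun _ : V => d) (by
        rw [hsum, Finset.sum_const, Finset.card_univ, smul_eq_mul, mul_comm _ d]; omega)
    have h3 := ha u
    have h4 := hb v
    have h5 := hdeg v
    exact fin _ _ (by omega) (by omega)

end

/-! ### Extremal graphs: stars, complete graphs, the path on four vertices -/

theorem ncard_edgeSet_starOn {c : V} {A : Finset V} (hc : c ∉ A) :
    (starOn c A).edgeSet.ncard = A.card := by
  classical
  have : (starOn c A).edgeSet = ((A.image fun a => s(c, a)) : Finset (Sym2 V)) := by
    ext e
    induction e with
    | h x y =>
      rw [mem_edgeSet, starOn_adj, Finset.mem_coe, mem_starEdges]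
      constructor
      · exact fun h => h.2
      · refine fun h => ⟨?_, h⟩
        rintro rfl
        rcases h with ⟨rfl, h⟩ | ⟨rfl, h⟩ <;> exact hc h
  rw [this, Set.ncard_coe_finset, Finset.card_image_of_injective]
  exact fun a b h => Sym2.congr_right.1 h

section
variable [Fintype V]

theorem genEdgeConn_eq_zero_of_isolated {G : SimpleGraph V} {k : ℕ} (hk : 2 ≤ k)
    (hkV : k ≤ Fintype.card V) {u : V} (hu : ∀ x, ¬ G.Adj u x) : genEdgeConn G k = 0 := by
  classical
  have h1 := genEdgeConn_le_degree (G := G) hk hkV u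
  have h2 : G.degree u = 0 := by
    by_contra h
    obtain ⟨x, hx⟩ := (G.degree_pos_iff_exists_adj u).1 (Nat.pos_of_ne_zero h)
    exact hu x hx
  omega

theorem ncard_edgeSet_le (G : SimpleGraph V) :
    G.edgeSet.ncard ≤ (Fintype.card V).choose 2 := by
  classical
  rw [← coe_edgeFinset, Set.ncard_coe_finset]
  exact card_edgeFinset_le_card_choose_two

theorem ncard_edgeSet_top : (⊤ : SimpleGraph V).edgeSet.ncard = (Fintype.card V).choose 2 := by
  classical
  rw [← coe_edgeFinset, Set.ncard_coe_finset]
  exact card_edgeFinset_top_eq_card_choose_two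

theorem exists_ge_ncard_eq (G₀ : SimpleGraph V) {m : ℕ} (h₀ : G₀.edgeSet.ncard ≤ m)
    (hm : m ≤ (Fintype.card V).choose 2) : ∃ G, G₀ ≤ G ∧ G.edgeSet.ncard = m := by
  classical
  rw [← ncard_edgeSet_top] at hm
  rw [← coe_edgeFinset, Set.ncard_coe_finset] at h₀ hm
  obtain ⟨F, h1, h2, h3⟩ := Finset.exists_subsuperset_card_eq
    (edgeFinset_mono (le_top : G₀ ≤ ⊤)) h₀ hm
  refine ⟨fromEdgeSet F, ?_, ?_⟩
  · intro x y hxy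
    rw [fromEdgeSet_adj]
    exact ⟨h1 (mem_edgeFinset.2 hxy), hxy.ne⟩
  · rw [edgeSet_fromEdgeSet, sdiff_eq_left.2, Set.ncard_coe_finset, h3]
    rw [Set.disjoint_left]
    intro e he hd
    exact not_isDiag_of_mem_edgeSet _ (mem_edgeFinset.1 (h2 he)) hd

theorem genEdgeConn_compl_star_ge {k : ℕ} (hk : 2 ≤ k) (hkV : k ≤ Fintype.card V) {c : V}
    {A : Finset V} (hc : c ∉ A) (hA : A = ∅ ∨ (Odd k ∧ A.card ≤ k / 2)) :
    k / 2 + (Fintype.card V - k) ≤ genEdgeConn (starOn c A)ᶜ k := by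
  classical
  rcases hA with rfl | ⟨⟨p, hp⟩, hA⟩
  · have : starOn c (∅ : Finset V) = ⊥ := by
      ext x y
      simp [starOn_adj]
    rw [this, compl_bot]
    exact genEdgeConn_top_ge hk hkV
  · refine le_genEdgeConn hk hkV fun S hS => ?_
    have := compl_star_packs (S := S) (hS.trans hp) hc (by omega)
    rwa [hS, show p = k / 2 by omega] at this

theorem genEdgeConn_deleteEdges_ge (G : SimpleGraph V) {k : ℕ} (hk : 2 ≤ k)
    (hkV : k ≤ Fintype.card V) (e : Sym2 V) :
    genEdgeConn G k - 1 ≤ genEdgeConn (G.deleteEdges {e}) k := by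
  rcases Nat.eq_zero_or_pos (genEdgeConn G k) with h | h
  · omega
  · refine le_genEdgeConn hk hkV fun S hS => ?_
    subst hS
    refine Packs.delete_edge (Packs.mono (packs_genEdgeConn G hk) le_rfl subset_rfl ?_) e
    omega

theorem connSum_top {k : ℕ} (hk : 2 ≤ k) (hkV : k ≤ Fintype.card V) :
    connSum (⊤ : SimpleGraph V) k = (k / 2 + (Fintype.card V - k) : ℕ) := by
  have h1 := genEdgeConn_add_compl_le (⊤ : SimpleGraph V) hk hkV
  have h2 := genEdgeConn_top_ge hk hkV
  rw [connSum]
  omega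

/-- Fewer than $n-1$ edges leave any graph disconnected; with at least $n-1$ edges a spanning star
fits in, and its centre is isolated in the complement. -/
theorem exists_connProd_eq_zero {k m : ℕ} (hk : 2 ≤ k) (hkV : k ≤ Fintype.card V)
    (hm : m ≤ (Fintype.card V).choose 2) :
    ∃ G : SimpleGraph V, G.edgeSet.ncard = m ∧ connProd G k = 0 := by
  classical
  obtain ⟨c⟩ : Nonempty V := Fintype.card_pos_iff.1 (by omega)
  have hc : c ∉ Finset.univ.erase c := by simp
  have hs := ncard_edgeSet_starOn hc
  rw [Finset.card_erase_of_mem (Finset.mem_univ c), Finset.card_univ] at hs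
  by_cases h : m < Fintype.card V - 1
  · obtain ⟨G, -, hG⟩ := exists_ge_ncard_eq (⊥ : SimpleGraph V) (m := m) (by simp) hm
    refine ⟨G, hG, ?_⟩
    rw [connProd, genEdgeConn_of_not_connected G k hk hkV (not_connected_of_ncard (by omega))]
    simp
  · obtain ⟨G, hle, hG⟩ := exists_ge_ncard_eq (starOn c (Finset.univ.erase c)) (m := m)
      (by omega) hm
    refine ⟨G, hG, ?_⟩
    rw [connProd, genEdgeConn_eq_zero_of_isolated (G := Gᶜ) hk hkV (u := c)]
    · simp
    · intro x hx
      rw [compl_adj] at hx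
      exact hx.2 (hle (starOn_adj_center hc (by simpa using hx.1.symm)))

/-- The spanning star has a vertex of degree one and its complement an isolated vertex, so the sum
is at most $1$, while $L\ge 1$. -/
theorem exists_connSum_eq_boundL {k : ℕ} (hV : 6 ≤ Fintype.card V) (hk : 3 ≤ k)
    (hkV : k ≤ Fintype.card V) :
    ∃ G : SimpleGraph V, G.edgeSet.ncard = Fintype.card V - 1 ∧
      connSum G k = boundL (Fintype.card V) (Fintype.card V - 1) := by
  classical
  obtain ⟨c⟩ : Nonempty V := Fintype.card_pos_iff.1 (by omega)
  have hc : c ∉ Finset.univ.erase c := by simp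
  have hs := ncard_edgeSet_starOn hc
  rw [Finset.card_erase_of_mem (Finset.mem_univ c), Finset.card_univ] at hs
  refine ⟨_, hs, ?_⟩
  have hL := boundL_le_connSum hV hk hkV hs
  have h1 : 1 ≤ boundL (Fintype.card V) (Fintype.card V - 1) := by
    rw [boundL, if_neg (by omega)]
    exact le_max_left _ _
  have h2 : genEdgeConn (starOn c (Finset.univ.erase c))ᶜ k = 0 :=
    genEdgeConn_eq_zero_of_isolated (by omega) hkV (u := c) fun x hx => by
      rw [compl_adj] at hx
      exact hx.2 (starOn_adj_center hc (by simpa using hx.1.symm))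
  have h3 : genEdgeConn (starOn c (Finset.univ.erase c)) k ≤ 1 := by
    obtain ⟨u, hu⟩ := Fintype.exists_ne_of_one_lt_card (by omega) c
    refine (genEdgeConn_le_degree (by omega) hkV u).trans ?_
    refine Finset.card_le_one.2 ?_
    have : ∀ a, (starOn c (Finset.univ.erase c)).Adj u a → a = c := fun a ha => by
      rcases (starOn_adj.1 ha).2 with ⟨h, -⟩ | ⟨h, -⟩
      · exact (hu h).elim
      · exact h
    intro a ha b hb
    rw [mem_neighborFinset] at ha hb
    rw [this a ha, this b hb]
  rw [connSum] at hL ⊢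
  omega

end

theorem boundL_zero {n : ℕ} (hn : 2 ≤ n) : boundL n 0 = (n / 2 : ℕ) := by
  rw [boundL, if_pos (Nat.zero_le _)]
  have : ⌊(n : ℚ) / 2 - 2 * ((0 : ℕ) : ℚ) / ((n : ℚ) - 1)⌋ = ((n / 2 : ℕ) : ℤ) := by
    have := Rat.floor_natCast_div_natCast n 2
    push_cast at this ⊢
    rw [mul_zero, zero_div, sub_zero]
    exact this
  rw [this]
  omega

theorem two_mul_choose_two_pred {n : ℕ} (hn : 3 ≤ n) :
    2 * (n.choose 2 - 1) = n * (n - 2) + (n - 2) := by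
  have h := Nat.div_mul_cancel (Nat.even_mul_pred_self n).two_dvd
  rw [← Nat.choose_two_right] at h
  obtain ⟨q, rfl⟩ := Nat.exists_eq_add_of_le hn
  simp only [show 3 + q - 1 = q + 2 by omega, show 3 + q - 2 = q + 1 by omega] at h ⊢
  have e : (3 + q) * (q + 2) = (3 + q) * (q + 1) + (q + 3) := by ring
  omega

/-- One edge short of complete, $\lfloor 2m/n\rfloor=n-2$, so the second factor of $N$ vanishes. -/
theorem boundN_choose_two_pred {n : ℕ} (hn : 4 ≤ n) :
    n - 1 ≤ n.choose 2 - 1 ∧ ¬ n ∣ 2 * (n.choose 2 - 1) ∧ boundN n (n.choose 2 - 1) = 0 := by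
  have h := two_mul_choose_two_pred (show 3 ≤ n by omega)
  have hlarge : n * 2 ≤ n * (n - 2) := Nat.mul_le_mul_left _ (by omega)
  have hdvd : ¬ n ∣ 2 * (n.choose 2 - 1) := by
    rw [h]
    intro hd
    have := Nat.le_of_dvd (by omega) ((Nat.dvd_add_right (dvd_mul_right _ _)).1 hd)
    omega
  refine ⟨by omega, hdvd, ?_⟩
  have hq : (n * (n - 2) + (n - 2)) / n = n - 2 := by
    rw [Nat.mul_add_div (by omega), Nat.div_eq_of_lt (by omega), add_zero]
  rw [boundN, if_neg (by omega), if_neg hdvd, floor_two_mul_div, h, hq]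
  have : (n : ℤ) - 2 - ((n - 2 : ℕ) : ℤ) = 0 := by omega
  rw [this, mul_zero]

theorem boundN_four_three : boundN 4 3 = 1 := by
  rw [boundN, if_neg (by norm_num), if_neg (by norm_num), floor_two_mul_div]
  norm_num

instance decidableRelPathGraphAdj (n : ℕ) : DecidableRel (pathGraph n).Adj :=
  fun _ _ => decidable_of_iff _ pathGraph_adj.symm

/-- The path on four vertices and its complement are both connected, and $N(4,3)=1$. -/
theorem exists_connProd_eq_one :
    ∃ G : SimpleGraph (Fin 4), G.edgeSet.ncard = 3 ∧ connProd G 3 = 1 := by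
  have hN : (pathGraph 4).edgeSet.ncard = 3 := by
    rw [← coe_edgeFinset, Set.ncard_coe_finset]
    decide
  have h1 := one_le_genEdgeConn (k := 3) (by norm_num) (by simp) (pathGraph_connected 3)
  have hc : (pathGraph 4)ᶜ.Connected := by
    have h20 : (pathGraph 4)ᶜ.Adj 2 0 := by simp [pathGraph_adj]
    have h30 : (pathGraph 4)ᶜ.Adj 3 0 := by simp [pathGraph_adj]
    have h13 : (pathGraph 4)ᶜ.Adj 1 3 := by simp [pathGraph_adj]
    refine (connected_iff_exists_forall_reachable _).2 ⟨0, fun w => Reachable.symm ?_⟩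
    fin_cases w
    · rfl
    · exact h13.reachable.trans h30.reachable
    · exact h20.reachable
    · exact h30.reachable
  have h2 := one_le_genEdgeConn (k := 3) (by norm_num) (by simp) hc
  have h3 := connProd_le_boundN (G := pathGraph 4) (k := 3) (by simp) le_rfl (by simp) hN
    (by decide)
  refine ⟨pathGraph 4, hN, le_antisymm ?_ ?_⟩
  · rwa [Fintype.card_fin, boundN_four_three] at h3
  · rw [connProd]
    exact_mod_cast Nat.mul_le_mul h1 h2

/-! ### Complements of cycles for $k=3$ -/

/-- The tree with centre `v`, neighbours `p`, `q`, `w` of `v`, and `s` attached to `w`. -/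
def spider (v p q w s : V) : SimpleGraph V :=
  fromRel fun x y => (x = v ∧ (y = p ∨ y = q ∨ y = w)) ∨ (x = w ∧ y = s)

theorem spider_adj {v p q w s x y : V} : (spider v p q w s).Adj x y ↔
    x ≠ y ∧ (((x = v ∧ (y = p ∨ y = q ∨ y = w)) ∨ (x = w ∧ y = s)) ∨
      ((y = v ∧ (x = p ∨ x = q ∨ x = w)) ∨ (y = w ∧ x = s))) := by
  simp [spider]

/-- The five vertices may coincide: an edge whose ends agree disappears without harming
connectedness. The spider lists rely on this. -/
theorem spider_links {v p q w s : V} {S : Finset V} (hS : ∀ x ∈ S, x = p ∨ x = q ∨ x = s) :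
    (spider v p q w s).Links S := by
  have key : ∀ x y, (x = v ∧ (y = p ∨ y = q ∨ y = w)) ∨ (x = w ∧ y = s) →
      (spider v p q w s).Reachable y x := by
    intro x y h
    by_cases hxy : x = y
    · rw [hxy]
    · exact (Adj.reachable (spider_adj.2 ⟨hxy, Or.inl h⟩)).symm
  refine links_of_root v fun x hx => ?_
  rcases hS x hx with rfl | rfl | rfl
  · exact key v x (by simp)
  · exact key v x (by simp)
  · exact (key w x (by simp)).trans (key v w (by simp))

/-- The complement of the `n`-cycle on `0, …, n - 1`, as a graph on `ℕ`. -/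
def cycleCompl (n : ℕ) : SimpleGraph ℕ where
  Adj s t := s < n ∧ t < n ∧ s ≠ t ∧ s + 1 ≠ t ∧ t + 1 ≠ s ∧ s + (n - 1) ≠ t ∧ t + (n - 1) ≠ s
  symm := ⟨fun s t h => by omega⟩
  loopless := ⟨fun s h => h.2.2.1 rfl⟩

theorem cycleCompl_adj {n s t : ℕ} : (cycleCompl n).Adj s t ↔
    s < n ∧ t < n ∧ s ≠ t ∧ s + 1 ≠ t ∧ t + 1 ≠ s ∧ s + (n - 1) ≠ t ∧ t + (n - 1) ≠ s := Iff.rfl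

/-- The stars centred outside the neighbourhood `W` of `S` form a packing. -/
theorem joinOn_range_packs {n l : ℕ} (W : List ℕ) (S : Finset ℕ) (hS : ∀ x ∈ S, x ∈ W)
    (hl : l + W.length ≤ n) :
    (joinOn (Finset.range n \ W.toFinset) S).Packs S l := by
  have h := joinOn_packs (O := Finset.range n \ W.toFinset) (S := S) (by
    rw [Finset.disjoint_left]
    intro a ha haS
    exact (Finset.mem_sdiff.1 ha).2 (List.mem_toFinset.2 (hS a haS)))
  refine h.mono le_rfl subset_rfl ?_
  have h1 := Finset.le_card_sdiff W.toFinset (Finset.range n)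
  have h2 := W.toFinset_card_le
  rw [Finset.card_range] at h1
  omega

theorem Packs.sup_list {G G' : SimpleGraph V} {S : Finset V} {l : ℕ} (h : G.Packs S l)
    (hG : G ≤ G') (L : List (SimpleGraph V)) (hL : ∀ K ∈ L, K.Links S ∧ Disjoint G K ∧ K ≤ G')
    (hp : L.Pairwise Disjoint) : G'.Packs S (l + L.length) := by
  induction L generalizing G l with
  | nil => exact h.mono hG subset_rfl le_rfl
  | cons K L ih =>
    obtain ⟨h1, h2, h3⟩ := hL K (by simp)
    rw [List.pairwise_cons] at hp
    have := ih (h.succ h1 h2 le_rfl) (sup_le hG h3) (fun K' hK' => by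
      obtain ⟨h4, h5, h6⟩ := hL K' (by simp [hK'])
      exact ⟨h4, disjoint_sup_left.2 ⟨h5, hp.1 K' hK'⟩, h6⟩) hp.2
    rwa [List.length_cons, Nat.add_comm L.length, ← Nat.add_assoc]

/-- A vertex outside `W` gives a full star on `S`. Inside `W` it remains to find $|W|-4$ disjoint
spiders, whose edges avoid all these stars. -/
theorem cycleCompl_packs_of_spiders {n : ℕ} {S : Finset ℕ} (W : List ℕ)
    (L : List (ℕ × ℕ × ℕ × ℕ × ℕ)) (hS : ∀ x ∈ S, x ∈ W) (hWn : W.length ≤ n)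
    (hW : W.length ≤ L.length + 4)
    (hstar : ∀ t < n, t ∉ W → ∀ s ∈ S, (cycleCompl n).Adj t s)
    (hL : ∀ v p q w s, (v, p, q, w, s) ∈ L → (∀ x ∈ S, x = p ∨ x = q ∨ x = s) ∧
      (v ∈ W ∧ p ∈ W ∧ q ∈ W ∧ w ∈ W ∧ s ∈ W) ∧ (cycleCompl n).Adj v p ∧
      (cycleCompl n).Adj v q ∧ (cycleCompl n).Adj v w ∧ (cycleCompl n).Adj w s)
    (hp : L.Pairwise fun a b => ∀ x y, (spider a.1 a.2.1 a.2.2.1 a.2.2.2.1 a.2.2.2.2).Adj x y →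
      ¬ (spider b.1 b.2.1 b.2.2.1 b.2.2.2.1 b.2.2.2.2).Adj x y) :
    (cycleCompl n).Packs S (n - 4) := by
  have h := joinOn_range_packs (n := n) (l := n - W.length) W S hS (by omega)
  have := h.sup_list (G' := cycleCompl n) (fun x y hxy => ?_)
    (L.map fun a => spider a.1 a.2.1 a.2.2.1 a.2.2.2.1 a.2.2.2.2) (fun K hK => ?_) ?_
  · refine this.mono le_rfl subset_rfl ?_
    rw [List.length_map]
    omega
  · rw [joinOn_adj, Finset.mem_sdiff, Finset.mem_range, List.mem_toFinset, Finset.mem_sdiff,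
      Finset.mem_range, List.mem_toFinset] at hxy
    rcases hxy with ⟨-, ⟨h1, h2⟩ | ⟨h1, h2⟩⟩
    · exact hstar x h1.1 h1.2 y h2
    · exact (hstar y h1.1 h1.2 x h2).symm
  · obtain ⟨⟨v, p, q, w, s⟩, ha, rfl⟩ := List.mem_map.1 hK
    obtain ⟨h1, ⟨hv, hp, hq, hw, hs⟩, h3, h4, h5, h6⟩ := hL v p q w s ha
    refine ⟨spider_links h1, disjoint_left.2 fun x y hx hy => ?_, fun x y hxy => ?_⟩
    · simp only [joinOn_adj, Finset.mem_sdiff, List.mem_toFinset] at hx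
      simp only [spider_adj] at hy
      grind
    · rcases (spider_adj.1 hxy).2 with (⟨rfl, rfl | rfl | rfl⟩ | ⟨rfl, rfl⟩) |
        (⟨rfl, rfl | rfl | rfl⟩ | ⟨rfl, rfl⟩)
      · exact h3
      · exact h4
      · exact h5
      · exact h6
      · exact h3.symm
      · exact h4.symm
      · exact h5.symm
      · exact h6.symm
  · rw [List.pairwise_map]
    exact hp.imp fun h => disjoint_left.2 h

/-- `W` is the closed neighbourhood of `S` in the cycle. Its shape depends on which of the gaps
$i,j$ are $1$, $2$ or larger, and in each case $|W|-4$ explicit spiders are given. -/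
theorem cycleCompl_packs_of_le {n i j : ℕ} (hn : 9 ≤ n) (hi : 1 ≤ i) (hij : i ≤ j)
    (hijn : i + j + 3 ≤ n) : (cycleCompl n).Packs {1, 1 + i, 1 + i + j} (n - 4) := by
  rcases (by omega : i = 1 ∧ j = 1 ∨ i = 1 ∧ j = 2 ∨ i = 1 ∧ 3 ≤ j ∨ i = 2 ∧ j = 2 ∨
    i = 2 ∧ 3 ≤ j ∨ 3 ≤ i) with ⟨rfl, rfl⟩ | ⟨rfl, rfl⟩ | ⟨rfl, hj⟩ | ⟨rfl, rfl⟩ | ⟨rfl, hj⟩ | hi3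
  case' inl =>
    refine cycleCompl_packs_of_spiders [0, 1, 2, 3, 4] [(0, 2, 3, 3, 1)] ?_ ?_ ?_ ?_ ?_ ?_
  case' inr.inl =>
    refine cycleCompl_packs_of_spiders [0, 1, 2, 3, 4, 5] [(0, 2, 4, 4, 1), (5, 1, 2, 2, 4)]
      ?_ ?_ ?_ ?_ ?_ ?_
  case' inr.inr.inl =>
    refine cycleCompl_packs_of_spiders [0, 1, 2, 3, j + 1, j + 2, j + 3]
      [(j + 1, 1, 2, 1, j + 2), (j + 3, 1, 2, 2, j + 2), (0, 2, j + 2, 3, 1)] ?_ ?_ ?_ ?_ ?_ ?_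
  case' inr.inr.inr.inl =>
    refine cycleCompl_packs_of_spiders [0, 1, 2, 3, 4, 5, 6]
      [(0, 3, 5, 4, 1), (6, 1, 3, 2, 5), (3, 1, 5, 1, 3)] ?_ ?_ ?_ ?_ ?_ ?_
  case' inr.inr.inr.inr.inl =>
    refine cycleCompl_packs_of_spiders [0, 1, 2, 3, 4, j + 2, j + 3, j + 4]
      [(0, 3, j + 3, 3, 1), (4, 1, j + 3, j + 3, 3), (j + 2, 1, 3, 1, j + 3),
        (j + 4, 1, 3, 2, j + 3)] ?_ ?_ ?_ ?_ ?_ ?_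
  case' inr.inr.inr.inr.inr =>
    refine cycleCompl_packs_of_spiders [0, 1, 2, i, i + 1, i + 2, i + j, i + j + 1, i + j + 2]
      [(0, i + 1, i + j + 1, i, 1), (i + j, 1, i + 1, i, i + j + 1),
        (2, i + 1, i + j + 1, i + 1, 1), (i + 2, 1, i + j + 1, i + j + 1, i + 1),
        (i + j + 2, 1, i + 1, 1, i + j + 1)] ?_ ?_ ?_ ?_ ?_ ?_
  all_goals first
    | (simp only [List.length_cons, List.length_nil]; omega)
    | (intro t ht htW s hs
       simp only [List.mem_cons, List.not_mem_nil, Finset.mem_insert, Finset.mem_singleton,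
         cycleCompl_adj] at htW hs ⊢
       omega)
    | (intro x hx
       simp only [List.mem_cons, List.not_mem_nil, Finset.mem_insert, Finset.mem_singleton] at hx ⊢
       omega)
    | (intro v p q w s h
       simp only [List.mem_cons, List.not_mem_nil, Finset.mem_insert, Finset.mem_singleton,
         Prod.mk.injEq, cycleCompl_adj, or_false] at h ⊢
       refine ⟨fun x hx => ?_, ?_⟩ <;> omega)
    | (simp only [List.pairwise_cons, List.mem_cons, List.not_mem_nil, or_false, forall_eq_or_imp,
         forall_eq, List.Pairwise.nil, spider_adj, and_true, IsEmpty.forall_iff, implies_true]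
       repeat' apply And.intro
       all_goals (intro x y hx hy; omega))

theorem cycleCompl_packs {n i j : ℕ} (hn : 9 ≤ n) (hi : 1 ≤ i) (hj : 1 ≤ j)
    (hijn : i + j + 3 ≤ n) : (cycleCompl n).Packs {1, 1 + i, 1 + i + j} (n - 4) := by
  rcases le_total i j with hij | hij
  · exact cycleCompl_packs_of_le hn hi hij hijn
  -- The reflection $t\mapsto i+j+2-t$ modulo $n$ exchanges the two gaps.
  · have h := cycleCompl_packs_of_le hn hj hij (by omega)
    refine h.map (fun t => if t ≤ i + j + 2 then i + j + 2 - t else n + (i + j + 2) - t)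
      {t | t < n} ?_ (fun x y hxy => hxy.1) ?_ ?_
    · intro x hx y hy hxy
      simp only [Set.mem_ofPred_eq] at hx hy hxy
      split_ifs at hxy <;> omega
    · intro x y hxy
      rw [cycleCompl_adj] at hxy ⊢
      split_ifs <;> omega
    · intro y hy
      simp only [Finset.mem_insert, Finset.mem_singleton] at hy
      rcases hy with rfl | rfl | rfl
      · exact ⟨1 + j + i, by simp, by rw [if_pos (by omega)]; omega⟩
      · exact ⟨1 + j, by simp, by rw [if_pos (by omega)]; omega⟩
      · exact ⟨1, by simp, by rw [if_pos (by omega)]; omega⟩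

/-- The three cyclic gaps sum to $n\ge 9$, so one is at least $3$; the rotation by `r` makes it the
last. -/
theorem exists_gaps {n x y z : ℕ} (hn : 9 ≤ n) (hxy : x < y) (hyz : y < z) (hz : z < n) :
    ∃ r i j, 1 ≤ i ∧ 1 ≤ j ∧ i + j + 3 ≤ n ∧ ∀ t, t = x ∨ t = y ∨ t = z →
      t = (r + 1) % n ∨ t = (r + (1 + i)) % n ∨ t = (r + (1 + i + j)) % n := by
  have hmod : ∀ {s t : ℕ}, t < n → (s = t ∨ s = t + n) → t = s % n := by
    rintro s t ht (rfl | rfl)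
    · exact (Nat.mod_eq_of_lt ht).symm
    · rw [Nat.add_mod_right, Nat.mod_eq_of_lt ht]
  by_cases h3 : z + 3 ≤ n + x
  · refine ⟨x + n - 1, y - x, z - y, by omega, by omega, by omega, ?_⟩
    rintro t (rfl | rfl | rfl)
    · exact Or.inl (hmod (by omega) (by omega))
    · exact Or.inr (Or.inl (hmod (by omega) (by omega)))
    · exact Or.inr (Or.inr (hmod (by omega) (by omega)))
  · by_cases h1 : x + 3 ≤ y
    · refine ⟨y - 1, z - y, n + x - z, by omega, by omega, by omega, ?_⟩
      rintro t (rfl | rfl | rfl)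
      · exact Or.inr (Or.inr (hmod (by omega) (by omega)))
      · exact Or.inl (hmod (by omega) (by omega))
      · exact Or.inr (Or.inl (hmod (by omega) (by omega)))
    · refine ⟨z - 1, n + x - z, y - x, by omega, by omega, by omega, ?_⟩
      rintro t (rfl | rfl | rfl)
      · exact Or.inr (Or.inl (hmod (by omega) (by omega)))
      · exact Or.inr (Or.inr (hmod (by omega) (by omega)))
      · exact Or.inl (hmod (by omega) (by omega))

theorem compl_cycleGraph_packs {n : ℕ} (hn : 9 ≤ n) {S : Finset (Fin n)} (hS : S.card = 3) :
    (cycleGraph n)ᶜ.Packs S (n - 4) := by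
  obtain ⟨x, y, z, hxy, hyz, hSe⟩ : ∃ x y z : Fin n, x < y ∧ y < z ∧ ∀ t ∈ S,
      t = x ∨ t = y ∨ t = z := by
    let e := S.orderIsoOfFin hS
    refine ⟨e 0, e 1, e 2, ?_, ?_, fun t ht => ?_⟩
    · exact e.strictMono (by decide)
    · exact e.strictMono (by decide)
    · obtain ⟨q, hq⟩ := e.surjective ⟨t, ht⟩
      have : t = e q := by rw [hq]
      rw [this]
      fin_cases q <;> simp
  obtain ⟨r, i, j, hi, hj, hijn, ht⟩ := exists_gaps hn hxy hyz z.2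
  have hn0 : 0 < n := by omega
  have hval : ∀ t, t < n → (r + t) % n = r % n + t ∨ (r + t) % n + n = r % n + t := by
    intro t ht
    rw [← Nat.mod_add_mod]
    have := Nat.mod_lt r hn0
    generalize r % n = r' at this ⊢
    rcases Nat.lt_or_ge (r' + t) n with h | h
    · exact Or.inl (Nat.mod_eq_of_lt h)
    · rw [Nat.mod_eq_sub_mod h, Nat.mod_eq_of_lt (by omega)]
      omega
  refine (cycleCompl_packs hn hi hj hijn).map (fun t => (⟨(r + t) % n, Nat.mod_lt _ hn0⟩ : Fin n))
    {t | t < n} ?_ (fun x y hxy => hxy.1) ?_ ?_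
  · intro s hs t ht hst
    have h1 := hval s hs
    have h2 := hval t ht
    rw [Fin.mk.injEq] at hst
    simp only [Set.mem_ofPred_eq] at hs ht
    omega
  · intro s t hst
    rw [cycleCompl_adj] at hst
    have h1 := hval s hst.1
    have h2 := hval t hst.2.1
    have h3 := Nat.mod_lt (r + s) hn0
    have h4 := Nat.mod_lt (r + t) hn0
    rw [compl_adj, cycleGraph_adj', Fin.ne_iff_vne]
    simp only [Fin.val_sub]
    generalize (r + s) % n = a at *
    generalize (r + t) % n = b at *
    have hsub : ∀ u v, u < n → v < n → (n - u + v) % n = 1 → v = u + 1 ∨ v + n = u + 1 := by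
      intro u v hu hv h
      rcases Nat.lt_or_ge (n - u + v) n with h' | h'
      · rw [Nat.mod_eq_of_lt h'] at h
        omega
      · rw [Nat.mod_eq_sub_mod h', Nat.mod_eq_of_lt (by omega)] at h
        omega
    refine ⟨by omega, ?_⟩
    rintro (h | h)
    · have := hsub _ _ h4 h3 h
      omega
    · have := hsub _ _ h3 h4 h
      omega
  · intro w hw
    have := ht w (by
      rcases hSe w hw with rfl | rfl | rfl <;> simp)
    rcases this with h | h | h
    · exact ⟨1, by simp, Fin.ext h.symm⟩
    · exact ⟨1 + i, by simp, Fin.ext h.symm⟩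
    · exact ⟨1 + i + j, by simp, Fin.ext h.symm⟩

theorem ncard_edgeSet_cycleGraph {n : ℕ} (hn : 3 ≤ n) : (cycleGraph n).edgeSet.ncard = n := by
  classical
  obtain ⟨q, rfl⟩ := Nat.exists_eq_add_of_le' hn
  have h := sum_degrees_eq_twice_card_edges (cycleGraph (q + 3))
  simp only [cycleGraph_degree_three_le, Finset.sum_const, Finset.card_univ, Fintype.card_fin,
    smul_eq_mul] at h
  rw [← coe_edgeFinset, Set.ncard_coe_finset]
  omega

theorem boundN_self {n : ℕ} (hn : 2 ≤ n) : boundN n n = n - 4 := by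
  rw [boundN, if_neg (by omega), if_pos (dvd_mul_left n 2), Nat.mul_div_cancel _ (by omega)]
  push_cast
  ring

/-- The average degree is $2$, so $N=n-4$; the cycle contributes a factor at least $1$ and its
complement at least $n-4$. -/
theorem connProd_cycleGraph {n : ℕ} (hn : 9 ≤ n) : connProd (cycleGraph n) 3 = boundN n n := by
  have hm := ncard_edgeSet_cycleGraph (show 3 ≤ n by omega)
  have h1 : 1 ≤ genEdgeConn (cycleGraph n) 3 := by
    refine one_le_genEdgeConn (by norm_num) (by simp; omega) ?_
    obtain ⟨q, rfl⟩ := Nat.exists_eq_add_of_le' (show 1 ≤ n by omega)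
    exact cycleGraph_connected
  have h2 : n - 4 ≤ genEdgeConn (cycleGraph n)ᶜ 3 :=
    le_genEdgeConn (by norm_num) (by simp; omega) fun S hS => compl_cycleGraph_packs hn hS
  have h3 := connProd_le_boundN (G := cycleGraph n) (k := 3) (by simp; omega) le_rfl
    (by simp; omega) hm (by
      rw [Fintype.card_fin, Nat.choose_two_right, Nat.lt_div_iff_mul_lt (by norm_num)]
      have : n * 8 ≤ n * (n - 1) := Nat.mul_le_mul_left _ (by omega)
      omega)
  rw [Fintype.card_fin] at h3
  refine le_antisymm h3 ?_
  rw [boundN_self (by omega), connProd]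
  have := Nat.mul_le_mul h1 h2
  have h4 : ((1 * (n - 4) : ℕ) : ℤ) ≤
      (genEdgeConn (cycleGraph n) 3 * genEdgeConn (cycleGraph n)ᶜ 3 : ℕ) := by
    exact_mod_cast this
  push_cast at h4
  omega

/-! ### Sharpness of $M$ and conclusion -/

theorem exists_connSum_eq_boundM_first {V : Type*} [Fintype V] {k m : ℕ} (hk : 3 ≤ k)
    (hkV : k ≤ Fintype.card V) (hm : (Even k ∧ m = 0) ∨ (Odd k ∧ m ≤ (k - 1) / 2)) :
    ∃ G : SimpleGraph V, G.edgeSet.ncard = m ∧ connSum G k = boundM k (Fintype.card V) m := by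
  classical
  obtain ⟨c⟩ : Nonempty V := Fintype.card_pos_iff.1 (by omega)
  obtain ⟨A, hA, hAm⟩ := Finset.exists_subset_card_eq (s := Finset.univ.erase c) (n := m) (by
    rw [Finset.card_erase_of_mem (Finset.mem_univ c), Finset.card_univ]
    omega)
  have hc : c ∉ A := fun h => Finset.ne_of_mem_erase (hA h) rfl
  have hn := (ncard_edgeSet_starOn hc).trans hAm
  refine ⟨starOn c A, hn, le_antisymm (connSum_le_boundM hk hkV hn) ?_⟩
  rw [boundM_of_first (Or.inr hm) hkV, connSum]
  have := genEdgeConn_compl_star_ge (by omega) hkV hc (k := k) (hm.imp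
    (fun h => Finset.card_eq_zero.1 (hAm.trans h.2)) fun h => ⟨h.1, by
      have := h.2
      obtain ⟨p, hp⟩ := h.1
      omega⟩)
  omega

theorem exists_connSum_eq_boundM_second {V : Type*} [Fintype V] {k : ℕ} (hV : 6 ≤ Fintype.card V)
    (hk : 3 ≤ k) (hkV : k ≤ Fintype.card V) :
    ∃ m, ((Even k ∧ 1 ≤ m) ∨ (Odd k ∧ (k + 1) / 2 ≤ m)) ∧ m < Fintype.card V - 1 ∧
      ∃ G : SimpleGraph V, G.edgeSet.ncard = m ∧ connSum G k = boundM k (Fintype.card V) m := by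
  classical
  obtain ⟨c⟩ : Nonempty V := Fintype.card_pos_iff.1 (by omega)
  obtain ⟨m, hm, hmn⟩ : ∃ m, (Even k ∧ m = 0 ∨ Odd k ∧ m = k / 2) ∧ m + 1 < Fintype.card V - 1 := by
    rcases Nat.even_or_odd k with h | h
    · exact ⟨0, Or.inl ⟨h, rfl⟩, by omega⟩
    · exact ⟨k / 2, Or.inr ⟨h, rfl⟩, by omega⟩
  have hcard := Finset.card_erase_of_mem (Finset.mem_univ c)
  rw [Finset.card_univ] at hcard
  obtain ⟨A, hA, hAm⟩ := Finset.exists_subset_card_eq (s := Finset.univ.erase c) (n := m) (by omega)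
  obtain ⟨a, ha⟩ := Finset.card_pos.1 (show 0 < (Finset.univ.erase c \ A).card by
    rw [Finset.card_sdiff_of_subset hA]
    omega)
  obtain ⟨hac, haA⟩ := Finset.mem_sdiff.1 ha
  have hc : c ∉ A := fun h => Finset.ne_of_mem_erase (hA h) rfl
  have hca : c ∉ insert a A := by
    rw [Finset.mem_insert, not_or]
    exact ⟨(Finset.ne_of_mem_erase hac).symm, hc⟩
  have hn := ncard_edgeSet_starOn hca
  rw [Finset.card_insert_of_notMem haA, hAm] at hn
  have hodd : Odd k → (k + 1) / 2 = k / 2 + 1 := by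
    rintro ⟨p, rfl⟩
    omega
  have hrange : (Even k ∧ 1 ≤ m + 1) ∨ (Odd k ∧ (k + 1) / 2 ≤ m + 1) :=
    hm.imp (fun h => ⟨h.1, by omega⟩) fun h => ⟨h.1, by rw [hodd h.1, h.2]⟩
  refine ⟨m + 1, hrange, hmn, starOn c (insert a A), hn,
    le_antisymm (connSum_le_boundM hk hkV hn) ?_⟩
  have hnf : ¬ FirstCaseM k (Fintype.card V) (m + 1) := by
    rintro (h | h | ⟨h1, h2⟩)
    · omega
    · omega
    · rcases hm with h | h
      · exact (Nat.not_even_iff_odd.2 h1) h.1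
      · omega
  -- The star with `m` leaves still attains the larger value of $M$; one further leaf deletes one
  -- edge of the complement and costs at most one.
  have h1 := genEdgeConn_compl_star_ge (by omega) hkV hc (k := k) (hm.imp
    (fun h => Finset.card_eq_zero.1 (hAm.trans h.2)) fun h => ⟨h.1, (hAm.trans h.2).le⟩)
  have h2 := genEdgeConn_deleteEdges_ge (starOn c A)ᶜ (by omega) hkV s(c, a) (k := k)
  have h3 : genEdgeConn ((starOn c A)ᶜ.deleteEdges {s(c, a)}) k ≤
      genEdgeConn (starOn c (insert a A))ᶜ k := by
    refine genEdgeConn_mono (by omega) hkV fun x y hxy => ?_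
    rw [deleteEdges_adj, compl_adj, starOn_adj, Set.mem_singleton_iff, Sym2.eq_iff] at hxy
    rw [compl_adj, starOn_adj, Finset.mem_insert, Finset.mem_insert]
    tauto
  rw [boundM_of_not_first hnf hkV, connSum]
  omega

theorem boundN_of_le {n m : ℕ} (h : m + 2 ≤ n) : boundN n m = 0 := by
  rw [boundN, if_pos h]

end SimpleGraph

open SimpleGraph in
theorem theorem4 (n k : ℕ) (hn : 6 ≤ n) (hk : 3 ≤ k) (hkn : k ≤ n) :
    -- the bounds, for every graph with `n` vertices and `m` edges
    (∀ (V : Type*) [Fintype V] (G : SimpleGraph V) (m : ℕ),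
      Fintype.card V = n → G.edgeSet.ncard = m →
        (boundL n m ≤ connSum G k ∧ connSum G k ≤ boundM k n m) ∧
        (0 ≤ connProd G k ∧ (m < n.choose 2 → connProd G k ≤ boundN n m))) ∧
    -- the lower bound for the sum is attained in both cases
    (∃ m : ℕ, n / 3 + 1 ≤ m ∧ m ≤ n.choose 2 ∧
      ∃ G : SimpleGraph (Fin n), G.edgeSet.ncard = m ∧ connSum G k = boundL n m) ∧
    (k = n → ∃ m : ℕ, m ≤ n / 3 ∧
      ∃ G : SimpleGraph (Fin n), G.edgeSet.ncard = m ∧ connSum G k = boundL n m) ∧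
    -- the upper bound for the sum is attained in all cases
    (∃ m : ℕ, n - 1 ≤ m ∧ m ≤ n.choose 2 ∧
      ∃ G : SimpleGraph (Fin n), G.edgeSet.ncard = m ∧ connSum G k = boundM k n m) ∧
    (∀ m : ℕ, (Even k ∧ m = 0) ∨ (Odd k ∧ m ≤ (k - 1) / 2) →
      ∃ G : SimpleGraph (Fin n), G.edgeSet.ncard = m ∧ connSum G k = boundM k n m) ∧
    (∃ m : ℕ, ((Even k ∧ 1 ≤ m) ∨ (Odd k ∧ (k + 1) / 2 ≤ m)) ∧ m < n - 1 ∧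
      ∃ G : SimpleGraph (Fin n), G.edgeSet.ncard = m ∧ connSum G k = boundM k n m) ∧
    -- the lower bound for the product is attained for every number of edges
    (∀ m : ℕ, m ≤ n.choose 2 →
      ∃ G : SimpleGraph (Fin n), G.edgeSet.ncard = m ∧ connProd G k = 0) ∧
    -- the upper bound for the product is attained in all cases
    (∀ m : ℕ, m ≤ n - 2 →
      ∃ G : SimpleGraph (Fin n), G.edgeSet.ncard = m ∧ connProd G k = boundN n m) ∧
    (k = 3 → 9 ≤ n →
      ∃ G : SimpleGraph (Fin n), G.edgeSet.ncard = n ∧ connProd G k = boundN n n) ∧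
    (∃ m : ℕ, n - 1 ≤ m ∧ m < n.choose 2 ∧ ¬ n ∣ 2 * m ∧
      ∃ G : SimpleGraph (Fin n), G.edgeSet.ncard = m ∧ connProd G k = boundN n m) ∧
    -- the third case of the upper bound for the product, with a positive value, at order four
    (0 < boundN 4 3 ∧
      ∃ G : SimpleGraph (Fin 4), G.edgeSet.ncard = 3 ∧ connProd G 3 = boundN 4 3) := by
  have hc : Fintype.card (Fin n) = n := Fintype.card_fin n
  refine ⟨?_, ?_, ?_, ?_, ?_, ?_, ?_, ?_, ?_, ?_, ?_⟩
  · rintro V _ G m rfl hm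
    refine ⟨⟨boundL_le_connSum hn hk hkn hm, connSum_le_boundM hk hkn hm⟩, ?_,
      fun h => connProd_le_boundN (by omega) hk hkn hm h⟩
    unfold connProd
    positivity
  · obtain ⟨G, h1, h2⟩ := exists_connSum_eq_boundL (V := Fin n) (k := k) (by omega) hk (by omega)
    rw [hc] at h1 h2
    have h3 := ncard_edgeSet_le G
    rw [h1, hc] at h3
    exact ⟨n - 1, by omega, h3, G, h1, h2⟩
  · rintro rfl
    -- At $m=0$ the bound is $\lfloor n/2\rfloor$, which is $\lambda_n(K_n)$.
    refine ⟨0, Nat.zero_le _, (⊤ : SimpleGraph (Fin k))ᶜ, by simp, ?_⟩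
    have h := connSum_top (V := Fin k) (k := k) (by omega) (by omega)
    rw [hc, Nat.sub_self, Nat.add_zero] at h
    rw [boundL_zero (by omega), ← h, connSum, connSum, compl_compl, add_comm]
  · have h := connSum_top (V := Fin n) (k := k) (by omega) (by omega)
    have h1 := ncard_edgeSet_top (V := Fin n)
    rw [hc] at h h1
    have h2 : n - 1 ≤ n.choose 2 := (boundN_choose_two_pred (by omega)).1.trans (Nat.sub_le _ _)
    refine ⟨n.choose 2, h2, le_rfl, ⊤, h1, ?_⟩
    rw [h, boundM_of_first (Or.inl h2) hkn]
  · intro m hm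
    have := exists_connSum_eq_boundM_first (V := Fin n) hk (by omega) hm
    rwa [hc] at this
  · have := exists_connSum_eq_boundM_second (V := Fin n) (k := k) (by omega) hk (by omega)
    rwa [hc] at this
  · intro m hm
    exact exists_connProd_eq_zero (by omega) (by omega) (by rwa [hc])
  · intro m hm
    rw [boundN_of_le (by omega)]
    refine exists_connProd_eq_zero (by omega) (by omega) ?_
    rw [hc]
    have := (boundN_choose_two_pred (n := n) (by omega)).1
    omega
  · rintro rfl h9
    exact ⟨cycleGraph n, ncard_edgeSet_cycleGraph (by omega), connProd_cycleGraph h9⟩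
  · obtain ⟨h1, h2, h3⟩ := boundN_choose_two_pred (n := n) (by omega)
    refine ⟨n.choose 2 - 1, h1, by omega, h2, ?_⟩
    rw [h3]
    exact exists_connProd_eq_zero (by omega) (by omega) (by rw [hc]; omega)
  · rw [boundN_four_three]
    exact ⟨one_pos, exists_connProd_eq_one⟩
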